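/- **Setting.** Let $\mathcal S,\mathcal A$ be finite non-empty sets, $S=|\mathcal S|$, $A=|\mathcal A|$, and consider an MDP with horizon $H\ge 2$, stages $h=0,\dots,H-1$, fixed initial state $s_0$, deterministic rewards $r_h:\mathcal S\times\mathcal A\to[0,1]$ and transition kernels $P^*_h(\cdot\mid s,a)$, $0\le h\le H-2$. For a deterministic Markov policy $\pi=(\pi_h)_h$ let $V_h^\pi(s)=\mathbb E_\pi\big[\sum_{t=h}^{H-1}r_t(s_t,a_t)\mid s_h=s\big]$, $V^\pi_H\equiv0$, $V_h^*(s)=\max_\pi V_h^\pi(s)$, $Q_h^*(s,a)=r_h(s,a)+\sum_{s'}P_h^*(s'\mid s,a)V_{h+1}^*(s')$. Let $$\mathrm{gap}^*=\min\Big\{\max_{a'}Q_h^*(s,a')-Q_h^*(s,a)\;:\;0\le h<H,\ s\in\mathcal S,\ a\notin\arg\max_{a'} Q_h^*(s,a')\Big\}>0 ,$$ with $\mathrm{gap}^*=\infty$ if there is no such triple $(s,a,h)$. **Algorithm (UCBVI).** Fix $\mu>0$, $\alpha\in[0,1]$ and a number $K$ of episodes. The bonus is $b_h^k(0)=\infty$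 and, for $n\ge1$, $$b_h^k(n)=(H-h-1)\sqrt{\frac{\tfrac12 S\ln2+\mu\,\kappa_k^\alpha}{n}},\qquad \kappa_k=\begin{cases}K&(K\text{-dependent bonus}),\\ k+1&(K\text{-independent bonus}).\end{cases}$$ In episode $k=0,\dots,K-1$, let $n_h^k(s,a)$ and $n_h^k(s,a,s')$ be the numbers of earlier episodes $i<k$ with $(s_h^i,a_h^i)=(s,a)$ and $(s_h^i,a_h^i,s_{h+1}^i)=(s,a,s')$, and let $\hat P_h^k(s'\mid s,a)=n_h^k(s,a,s')/n_h^k(s,a)$ if $n_h^k(s,a)\ge1$ and $1/S$ otherwise. Put $V_H^k\equiv0$ and, for $h=H-1,\dots,0$, $$Q_h^k(s,a)=\min\Big\{r_h(s,a)+\sum_{s'}\hat P_h^k(s'\mid s,a)V_{h+1}^k(s')+b_h^k\big(n_h^k(s,a)\big),\,H-h\Big\},\qquad V_h^k(s)=\max_aQ_h^k(s,a).$$ The learner commits to a policy $\pi^k$ with $\pi_h^k(s)\in\arg\max_aQ_h^k(s,a)$ for all $s,h$ (ties are broken in an arbitrary non-anticipating way) and observes a trajectory $s_0^k=s_0$,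 $a_h^k=\pi_h^k(s_h^k)$, $s_{h+1}^k\sim P_h^*(\cdot\mid s_h^k,a_h^k)$ given the past. The regret is $R_K=\sum_{k=0}^{K-1}\big(V_0^*(s_0)-V_0^{\pi^k}(s_0)\big)$. **Theorem.** For either bonus, every $\alpha\in[0,1]$, every $\gamma\in[0,1]$ and every $x\in\mathbb R$, $$\mathbb P(R_K\ge x)\le\exp\!\left(-\frac{\big(x-H\lceil K^\gamma\rceil-m_K\big)_+^2}{2H^3K}\right)+\delta_K,$$ where $(z)_+=\max\{z,0\}$, $$m_K=\frac{4H^2(H-1)(2H-1)\,SA\,\big(S\ln2+2\mu K^\alpha\big)}{3\,\mathrm{gap}^*}$$ (with $m_K=0$ if $\mathrm{gap}^*=\infty$), and $$\delta_K=\begin{cases}SAH\,K\exp(-2\mu K^\alpha)&(K\text{-dependent bonus}),\\ SAH\,K\exp(-2\mu K^{\gamma\alpha})&(K\text{-independent bonus}).\end{cases}$$ -/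

import Mathlib

open MeasureTheory ProbabilityTheory

/-- A finite-horizon tabular MDP with stages `0, …, H - 1`, fixed initial state `s₀`, deterministic
rewards in `[0, 1]` at the stages `h < H` and transition kernels at the stages `h ≤ H - 2`. The
functions are indexed by `ℕ`; their values at other stages play no role. -/
structure TabularMDP (S A : Type*) [Fintype S] where
  H : ℕ
  P : ℕ → S → A → S → ℝ
  r : ℕ → S → A → ℝ
  s₀ : S
  P_mem : ∀ h, h + 1 < H → ∀ s a, P h s a ∈ stdSimplex ℝ S
  r_mem : ∀ h, h < H → ∀ s a, r h s a ∈ Set.Icc (0 : ℝ) 1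

/-- A deterministic Markov policy: stage `h` and state `s` give an action. Only the stages `h < H`
matter. -/
abbrev MarkovPolicy (S A : Type*) := ℕ → S → A

/-- The two bonus schedules. -/
inductive BonusKind
  | kDependent
  | kIndependent

namespace TabularMDP

variable {S A : Type*} [Fintype S] [DecidableEq S] [DecidableEq A]

/-! ### Values, optimal values and the gap -/

/-- Probability of the state sequence `w 0, …, w m` at the stages `h, …, h + m` when policy `π` is
followed from state `s` at stage `h`. -/
noncomputable def pathProb (M : TabularMDP S A) (π : MarkovPolicy S A) (h : ℕ) (s : S) (m : ℕ)
    (w : Fin (m + 1) → S) : ℝ :=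
  (if w 0 = s then 1 else 0) *
    ∏ i : Fin m, M.P (h + i) (w i.castSucc) (π (h + i) (w i.castSucc)) (w i.succ)

/-- `V_h^π(s)`: expected sum of the rewards at the stages `h, …, H - 1`, started at `s` at stage
`h`; it is `0` for `h = H`. -/
noncomputable def value (M : TabularMDP S A) (π : MarkovPolicy S A) (h : ℕ) (s : S) : ℝ :=
  if h < M.H then
    ∑ w : Fin (M.H - 1 - h + 1) → S, M.pathProb π h s (M.H - 1 - h) w *
      ∑ i : Fin (M.H - 1 - h + 1), M.r (h + i) (w i) (π (h + i) (w i))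
  else 0

/-- `V_h^*(s)`, the maximum of `V_h^π(s)` over the deterministic Markov policies (the supremum is
over finitely many distinct values). -/
noncomputable def optValue (M : TabularMDP S A) (h : ℕ) (s : S) : ℝ :=
  ⨆ π : MarkovPolicy S A, M.value π h s

/-- `Q_h^*(s, a)`. -/
noncomputable def optQ (M : TabularMDP S A) (h : ℕ) (s : S) (a : A) : ℝ :=
  M.r h s a + ∑ s', M.P h s a s' * M.optValue (h + 1) s'

/-- `a ∈ argmax Q_h^*(s, ·)`. -/
def IsOptAction (M : TabularMDP S A) (h : ℕ) (s : S) (a : A) : Prop :=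
  ∀ a', M.optQ h s a' ≤ M.optQ h s a

/-- The global gap: the minimum, over the stages `h < H`, the states `s` and the non-optimal
actions `a`, of `Q_h^*(s, a⋆) - Q_h^*(s, a)` with `a⋆` optimal. The set is finite and consists of
positive numbers. If every action is optimal everywhere, the set is empty and the value is `0`. -/
noncomputable def gap (M : TabularMDP S A) : ℝ :=
  sInf {g | ∃ h < M.H, ∃ s a₀ a, M.IsOptAction h s a₀ ∧ ¬ M.IsOptAction h s a ∧
    g = M.optQ h s a₀ - M.optQ h s a}

/-! ### The planning step of UCBVI

Past data are given by the states `x i h` and the actions `u i h` of episode `i` at stage `h`. -/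

/-- `n_h^k(s, a)`: number of episodes `i < k` with `(s_h^i, a_h^i) = (s, a)`. -/
def visits (x : ℕ → ℕ → S) (u : ℕ → ℕ → A) (k h : ℕ) (s : S) (a : A) : ℕ :=
  ((Finset.range k).filter fun i => x i h = s ∧ u i h = a).card

/-- `n_h^k(s, a, s')`: number of episodes `i < k` with `(s_h^i, a_h^i, s_{h+1}^i) = (s, a, s')`. -/
def transitions (x : ℕ → ℕ → S) (u : ℕ → ℕ → A) (k h : ℕ) (s : S) (a : A) (s' : S) : ℕ :=
  ((Finset.range k).filter fun i => x i h = s ∧ u i h = a ∧ x i (h + 1) = s').card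

/-- The empirical kernel, uniform where there are no data. (At the last stage `h = H - 1` it is only
ever multiplied by `V_H^k = 0`.) -/
noncomputable def empP (x : ℕ → ℕ → S) (u : ℕ → ℕ → A) (k h : ℕ) (s : S) (a : A) (s' : S) : ℝ :=
  if visits x u k h s a = 0 then 1 / (Fintype.card S : ℝ)
  else (transitions x u k h s a s' : ℝ) / (visits x u k h s a : ℝ)

/-- The bonus `b_h^k(n)`, with `b_h^k(0) = ∞`. -/
noncomputable def bonus (M : TabularMDP S A) (β : BonusKind) (μ α : ℝ) (K k h n : ℕ) : EReal :=
  if n = 0 then ⊤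
  else match β with
    | .kDependent => ((((M.H : ℝ) - h - 1) *
        Real.sqrt ((0.5 * Fintype.card S * Real.log 2 + μ * (K : ℝ) ^ α) / n) : ℝ) : EReal)
    | .kIndependent => ((((M.H : ℝ) - h - 1) *
        Real.sqrt ((0.5 * Fintype.card S * Real.log 2 + μ * ((k : ℝ) + 1) ^ α) / n) : ℝ) : EReal)

/-- One backup: `min {r_h(s,a) + ∑ s', P̂_h^k(s'|s,a) V(s') + b_h^k(n_h^k(s,a)), H - h}`. The
minimum is always a real number. -/
noncomputable def backup (M : TabularMDP S A) (β : BonusKind) (μ α : ℝ) (K : ℕ)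
    (x : ℕ → ℕ → S) (u : ℕ → ℕ → A) (k h : ℕ) (V : S → ℝ) (s : S) (a : A) : ℝ :=
  (min (((M.r h s a + ∑ s', empP x u k h s a s' * V s' : ℝ) : EReal)
      + M.bonus β μ α K k h (visits x u k h s a)) (((M.H : ℝ) - h : ℝ) : EReal)).toReal

/-- Backward recursion: `planAux … m` is the value function `V_{H - m}^k`. -/
noncomputable def planAux (M : TabularMDP S A) (β : BonusKind) (μ α : ℝ) (K : ℕ)
    (x : ℕ → ℕ → S) (u : ℕ → ℕ → A) (k : ℕ) : ℕ → S → ℝ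
  | 0 => fun _ => 0
  | m + 1 => fun s => ⨆ a, M.backup β μ α K x u k (M.H - (m + 1)) (planAux M β μ α K x u k m) s a

/-- The optimistic value function `V_h^k`. -/
noncomputable def planV (M : TabularMDP S A) (β : BonusKind) (μ α : ℝ) (K : ℕ)
    (x : ℕ → ℕ → S) (u : ℕ → ℕ → A) (k h : ℕ) : S → ℝ :=
  M.planAux β μ α K x u k (M.H - h)

/-- The optimistic action-value function `Q_h^k`. -/
noncomputable def planQ (M : TabularMDP S A) (β : BonusKind) (μ α : ℝ) (K : ℕ)
    (x : ℕ → ℕ → S) (u : ℕ → ℕ → A) (k h : ℕ) (s : S) (a : A) : ℝ :=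
  M.backup β μ α K x u k h (M.planV β μ α K x u k (h + 1)) s a

/-! ### Runs of UCBVI and the regret -/

/-- The actions `a_h^k = π_h^k(s_h^k)`. -/
def actions {Ω : Type*} (x : ℕ → ℕ → Ω → S) (π : ℕ → Ω → MarkovPolicy S A) (ω : Ω) (k h : ℕ) : A :=
  π k ω h (x k h ω)

/-- `x k h` (the state of episode `k` at stage `h`) and `π k` (the policy of episode `k`) form a run
of UCBVI over `K` episodes on the probability space `(Ω, Pr)`. The filtration is the flow of
information, time `k * H + h` being stage `h` of episode `k`. Ties in the argmax may be broken in any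
non-anticipating way, possibly depending on the past or on independent randomization. -/
structure IsUCBVIRun {Ω : Type*} {mΩ : MeasurableSpace Ω} (M : TabularMDP S A) (β : BonusKind)
    (μ α : ℝ) (K : ℕ) (Pr : Measure Ω) (ℱ : Filtration ℕ mΩ) (x : ℕ → ℕ → Ω → S)
    (π : ℕ → Ω → MarkovPolicy S A) : Prop where
  state_adapted : ∀ k < K, ∀ h < M.H, ∀ s, MeasurableSet[ℱ (k * M.H + h)] {ω | x k h ω = s}
  policy_adapted : ∀ k < K, ∀ h < M.H, ∀ s a, MeasurableSet[ℱ (k * M.H)] {ω | π k ω h s = a}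
  start : ∀ k < K, ∀ᵐ ω ∂Pr, x k 0 ω = M.s₀
  greedy : ∀ k < K, ∀ᵐ ω ∂Pr, ∀ h < M.H, ∀ s a,
    M.planQ β μ α K (fun i j => x i j ω) (actions x π ω) k h s a ≤
      M.planQ β μ α K (fun i j => x i j ω) (actions x π ω) k h s (π k ω h s)
  transition : ∀ k < K, ∀ h, h + 1 < M.H → ∀ s',
    Pr[{ω | x k (h + 1) ω = s'}.indicator (fun _ => (1 : ℝ)) | ℱ (k * M.H + h)] =ᵐ[Pr]
      fun ω => M.P h (x k h ω) (actions x π ω k h) s'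

/-- The cumulative regret `R_K`. -/
noncomputable def regret {Ω : Type*} (M : TabularMDP S A) (K : ℕ) (π : ℕ → Ω → MarkovPolicy S A)
    (ω : Ω) : ℝ :=
  ∑ k ∈ Finset.range K, (M.optValue 0 M.s₀ - M.value (π k ω) 0 M.s₀)

/-- The baseline level `m_K`. (When every action is optimal everywhere, this is `0`, the value
corresponding to an infinite gap.) -/
noncomputable def baseline [Fintype A] (M : TabularMDP S A) (μ α : ℝ) (K : ℕ) : ℝ :=
  4 * (M.H : ℝ) ^ 2 * ((M.H : ℝ) - 1) * (2 * (M.H : ℝ) - 1) * Fintype.card S * Fintype.card A *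
    (Fintype.card S * Real.log 2 + 2 * μ * (K : ℝ) ^ α) / (3 * M.gap)

/-- The residual term `δ_K`. -/
noncomputable def residual [Fintype A] (M : TabularMDP S A) (β : BonusKind) (μ α γ : ℝ) (K : ℕ) :
    ℝ :=
  (Fintype.card S : ℝ) * Fintype.card A * M.H *
    (match β with
      | .kDependent => (K : ℝ) * Real.exp (-(2 * μ * (K : ℝ) ^ α))
      | .kIndependent => (K : ℝ) * Real.exp (-(2 * μ * (K : ℝ) ^ (γ * α))))

end TabularMDP

/-! UCBVI is optimistic once the empirical kernels are close to the true ones in total variation.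
Hoeffding's inequality for each stage, state-action pair, visit count and subset of states, with a
union bound, gives failure probability at most `residual`: the term `S ln 2 / 2` of the bonus pays
for the `2 ^ S` subsets (`measureReal_not_concentrated_le`). With the `K`-independent bonus the
width needed for this is guaranteed from episode `k₀ = ⌈K ^ γ⌉` on; each earlier episode costs at
most `H`.

On the good event the surplus of `Q_h^k` at a visited pair is at most twice the bonus. It is lowered
by a clipping level `gap / (2 (H - 1))` at every stage but the last, so clipping loses at most `gap
/ 2` in total. Let `W` be the expected clipped surplus collected by `π^k`, truncated at each stage
at the number of remaining stages (`potential`), and let `Δ = V^* - V^{π^k}`. Where the action is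
optimal, `Δ` is the mean of the next-stage `Δ`. Elsewhere `gap ≤ Δ`, and optimism gives `Δ ≤ W + gap
/ 2 ≤ W + Δ / 2`. Hence `Δ ≤ 2 W` everywhere (`optValue_sub_le_potential`).

Along the trajectory, `2 W` is at most twice the collected clipped bonuses plus martingale
increments (`potential_le_sum`). The bonuses are bounded for every data sequence, because the sum
over `n ≥ 1` of the positive parts of `C / √n - ε` is at most `C² / ε`; this yields `baseline`
(`sum_clippedBonus_visits_le`). Truncation keeps `W` in `[0, H]`, so each increment has conditional
range at most `2 H`, and Azuma–Hoeffding over `K H` steps gives the exponent `z² / (2 H³ K)`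
(`measureReal_sum_increment_le`). -/

namespace TabularMDP

/-! ### Bellman equations and optimal values. -/

section Values

variable {S A : Type*} [Fintype S] [DecidableEq S]

/-- Conditioning on the first transition. The general `F` serves both the total mass and the reward
sum. -/
lemma sum_pathProb_succ (M : TabularMDP S A) (π : MarkovPolicy S A) (h : ℕ) (s : S) (m : ℕ)
    (F : (Fin (m + 2) → S) → ℝ) :
    ∑ w, M.pathProb π h s (m + 1) w * F w =
      ∑ s', M.P h s (π h s) s' *
        ∑ w, M.pathProb π (h + 1) s' m w * F (Fin.cons s w : Fin (m + 2) → S) := by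
  rw [← (Fin.consEquiv fun _ : Fin (m + 2) => S).sum_comp, Fintype.sum_prod_type,
    Finset.sum_eq_single s]
  · simp only [Finset.mul_sum]
    rw [Finset.sum_comm]
    refine Finset.sum_congr rfl fun w _ => ?_
    rw [Finset.sum_eq_single (w 0)]
    · simp [pathProb, Fin.consEquiv, Fin.prod_univ_succ, add_assoc, add_comm 1, mul_assoc]
    · intro b _ hb
      simp [pathProb, hb.symm]
    · simp
  · intro b _ hb
    simp [pathProb, Fin.consEquiv, hb]
  · simp

lemma sum_pathProb (M : TabularMDP S A) (π : MarkovPolicy S A) (m : ℕ) :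
    ∀ h s, h + m < M.H → ∑ w, M.pathProb π h s m w = 1 := by
  induction m with
  | zero =>
    intro h s _
    rw [← (Equiv.funUnique (Fin 1) S).symm.sum_comp]
    simp [pathProb]
  | succ m ih =>
    intro h s hm
    have := M.sum_pathProb_succ π h s m fun _ => 1
    simp only [mul_one] at this
    rw [this, ← (M.P_mem h (by omega) s (π h s)).2]
    refine Finset.sum_congr rfl fun s' _ => ?_
    rw [ih (h + 1) s' (by omega), mul_one]

lemma value_of_le (M : TabularMDP S A) (π : MarkovPolicy S A) {h : ℕ} (hh : M.H ≤ h) (s : S) :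
    M.value π h s = 0 := by
  simp [value, hh.not_gt]

lemma value_eq (M : TabularMDP S A) (π : MarkovPolicy S A) {h : ℕ} (hh : h < M.H) (s : S) :
    M.value π h s = M.r h s (π h s) + ∑ s', M.P h s (π h s) s' * M.value π (h + 1) s' := by
  obtain ⟨m, hm⟩ := Nat.exists_eq_add_of_lt hh
  have e : M.H - 1 - h = m := by omega
  rw [value, if_pos hh, e]
  cases m with
  | zero =>
    rw [← (Equiv.funUnique (Fin 1) S).symm.sum_comp]
    simp [pathProb, M.value_of_le π (show M.H ≤ h + 1 by omega)]
  | succ m =>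
    rw [sum_pathProb_succ]
    have e' : M.H - 1 - (h + 1) = m := by omega
    have key : ∀ s', M.value π (h + 1) s' + M.r h s (π h s) =
        ∑ w, M.pathProb π (h + 1) s' m w * ∑ i : Fin (m + 2),
          M.r (h + i) ((Fin.cons s w : Fin (m + 2) → S) i)
            (π (h + i) ((Fin.cons s w : Fin (m + 2) → S) i)) := by
      intro s'
      rw [value, if_pos (by omega), e']
      simp only [Fin.sum_univ_succ (n := m + 1), mul_add, Finset.sum_add_distrib, Fin.cons_zero,
        Fin.cons_succ, ← Finset.sum_mul, M.sum_pathProb π m (h + 1) s' (by omega)]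
      simp [add_comm, add_left_comm]
    simp only [← key, mul_add, Finset.sum_add_distrib, ← Finset.sum_mul,
      (M.P_mem h (by omega) s (π h s)).2]
    ring

omit [DecidableEq S] in
-- `M.P` is known to be a kernel only before the last stage. At the last stage its entries are
-- unconstrained, and `h0` makes the two sums equal.
lemma sum_P_mul_mono (M : TabularMDP S A) {h : ℕ} (hh : h < M.H) (s : S) (a : A) {f g : S → ℝ}
    (hfg : ∀ s', f s' ≤ g s') (h0 : h + 1 = M.H → ∀ s', f s' = g s') :
    ∑ s', M.P h s a s' * f s' ≤ ∑ s', M.P h s a s' * g s' := by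
  rcases (Nat.succ_le_of_lt hh).lt_or_eq with h1 | h1
  · exact Finset.sum_le_sum fun s' _ =>
      mul_le_mul_of_nonneg_left (hfg s') ((M.P_mem h h1 s a).1 s')
  · exact (Finset.sum_congr rfl fun s' _ => by rw [h0 h1 s']).le

omit [DecidableEq S] in
lemma sum_P_mul_nonneg (M : TabularMDP S A) {h : ℕ} (hh : h < M.H) (s : S) (a : A) {f : S → ℝ}
    (hf : ∀ s', 0 ≤ f s') (h0 : h + 1 = M.H → ∀ s', f s' = 0) :
    0 ≤ ∑ s', M.P h s a s' * f s' := by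
  simpa using M.sum_P_mul_mono hh s a (f := fun _ => 0) hf fun h1 s' => (h0 h1 s').symm

omit [DecidableEq S] in
lemma sum_P_mul_le (M : TabularMDP S A) {h : ℕ} (hh : h < M.H) (s : S) (a : A) {f : S → ℝ}
    (hf : ∀ s', f s' ≤ (M.H : ℝ) - (h + 1 : ℕ)) (h0 : h + 1 = M.H → ∀ s', f s' = 0) :
    ∑ s', M.P h s a s' * f s' ≤ (M.H : ℝ) - (h + 1 : ℕ) := by
  refine (M.sum_P_mul_mono hh s a hf fun h1 s' => ?_).trans ?_
  · rw [h0 h1, ← h1, sub_self]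
  · rcases (Nat.succ_le_of_lt hh).lt_or_eq with h1 | h1
    · rw [← Finset.sum_mul, (M.P_mem h h1 s a).2, one_mul]
    · simp [← h1]

omit [DecidableEq S] in
/-- Downward induction on the stage, starting from the horizon. -/
lemma stage_induction (M : TabularMDP S A) {p : ℕ → Prop} (h0 : p M.H)
    (hs : ∀ h < M.H, p (h + 1) → p h) : ∀ h ≤ M.H, p h := fun _ hh =>
  Nat.decreasingInduction (motive := fun k _ => p k) (fun k hk => hs k hk) h0 hh

lemma value_mem (M : TabularMDP S A) (π : MarkovPolicy S A) :
    ∀ h ≤ M.H, ∀ s, M.value π h s ∈ Set.Icc (0 : ℝ) ((M.H : ℝ) - h) := by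
  refine M.stage_induction (fun s => by simp [M.value_of_le π le_rfl s]) fun h hh ih s => ?_
  have hr := M.r_mem h hh s (π h s)
  have h0 : h + 1 = M.H → ∀ s', M.value π (h + 1) s' = 0 := fun h1 s' => M.value_of_le π h1.ge s'
  have h2 := M.sum_P_mul_nonneg hh s (π h s) (fun s' => (ih s').1) h0
  have h3 := M.sum_P_mul_le hh s (π h s) (fun s' => (ih s').2) h0
  rw [M.value_eq π hh]
  push_cast at h3
  exact ⟨by linarith [hr.1], by linarith [hr.2]⟩

variable [Nonempty A]

omit [Nonempty A] in
lemma bddAbove_value (M : TabularMDP S A) {h : ℕ} (hh : h ≤ M.H) (s : S) :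
    BddAbove (Set.range fun π : MarkovPolicy S A => M.value π h s) :=
  ⟨(M.H : ℝ) - h, by rintro _ ⟨π, rfl⟩; exact (M.value_mem π h hh s).2⟩

omit [Nonempty A] in
lemma value_le_optValue (M : TabularMDP S A) (π : MarkovPolicy S A) {h : ℕ} (hh : h ≤ M.H)
    (s : S) : M.value π h s ≤ M.optValue h s :=
  le_ciSup (M.bddAbove_value hh s) π

lemma optValue_mem (M : TabularMDP S A) {h : ℕ} (hh : h ≤ M.H) (s : S) :
    M.optValue h s ∈ Set.Icc (0 : ℝ) ((M.H : ℝ) - h) := by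
  let π : MarkovPolicy S A := fun _ _ => Classical.arbitrary A
  exact ⟨(M.value_mem π h hh s).1.trans (M.value_le_optValue π hh s),
    ciSup_le fun π => (M.value_mem π h hh s).2⟩

lemma optValue_horizon (M : TabularMDP S A) (s : S) : M.optValue M.H s = 0 := by
  simp [optValue, M.value_of_le _ le_rfl]

lemma exists_isOptAction [Finite A] (M : TabularMDP S A) (h : ℕ) (s : S) :
    ∃ a, M.IsOptAction h s a :=
  Finite.exists_max (M.optQ h s)

lemma value_le_optQ (M : TabularMDP S A) (π : MarkovPolicy S A) {h : ℕ} (hh : h < M.H) (s : S) :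
    M.value π h s ≤ M.optQ h s (π h s) := by
  rw [M.value_eq π hh, optQ]
  refine add_le_add_right ?_ _
  refine M.sum_P_mul_mono hh s _ (fun s' => M.value_le_optValue π hh s') fun h1 s' => ?_
  rw [M.value_of_le π h1.ge, h1, M.optValue_horizon]

/-- By backward induction, a policy greedy for `optQ` is optimal at all stages and states at once.
-/
lemma exists_value_eq_optValue [Finite A] (M : TabularMDP S A) :
    ∃ π : MarkovPolicy S A, ∀ h ≤ M.H, ∀ s, M.value π h s = M.optValue h s := by
  choose π hπ using M.exists_isOptAction
  refine ⟨π, M.stage_induction (fun s => by rw [M.value_of_le π le_rfl, M.optValue_horizon])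
    fun h hh ih s => ?_⟩
  refine (M.value_le_optValue π hh.le s).antisymm (ciSup_le fun π' => ?_)
  refine (M.value_le_optQ π' hh s).trans ((hπ h s _).trans ?_)
  simp [M.value_eq π hh, optQ, ih]

lemma optValue_eq_optQ [Finite A] (M : TabularMDP S A) {h : ℕ} (hh : h < M.H) {s : S} {a : A}
    (ha : M.IsOptAction h s a) : M.optValue h s = M.optQ h s a := by
  obtain ⟨π, hπ⟩ := M.exists_value_eq_optValue
  refine le_antisymm (ciSup_le fun π' => (M.value_le_optQ π' hh s).trans (ha _)) ?_
  -- Changing an optimal policy at stage `h` alone leaves the values at later stages optimal.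
  let π' : MarkovPolicy S A := fun t s' => if t = h then a else π t s'
  have h1 : ∀ t ≤ M.H, h < t → ∀ s', M.value π' t s' = M.value π t s' := by
    refine M.stage_induction (fun _ s' => by simp [M.value_of_le _ le_rfl]) fun t ht ih hlt s' => ?_
    rw [M.value_eq π' ht, M.value_eq π ht]
    simp [π', hlt.ne', ih (by omega)]
  refine le_trans (le_of_eq ?_) (M.value_le_optValue π' hh.le s)
  rw [M.value_eq π' hh, optQ]
  simp [π', h1 (h + 1) hh (by omega), hπ (h + 1) hh]

lemma optQ_le_optValue [Finite A] (M : TabularMDP S A) {h : ℕ} (hh : h < M.H) (s : S) (a : A) :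
    M.optQ h s a ≤ M.optValue h s := by
  obtain ⟨b, hb⟩ := M.exists_isOptAction h s
  exact (hb a).trans (M.optValue_eq_optQ hh hb).ge

lemma optQ_nonneg (M : TabularMDP S A) {h : ℕ} (hh : h < M.H) (s : S) (a : A) :
    0 ≤ M.optQ h s a :=
  add_nonneg (M.r_mem h hh s a).1 (M.sum_P_mul_nonneg hh s a (fun s' => (M.optValue_mem hh s').1)
    fun h1 s' => by rw [h1, M.optValue_horizon])

/-! ### The gap -/

/-- The finite set of positive suboptimality gaps. -/
def gapSet (M : TabularMDP S A) : Set ℝ :=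
  {g | ∃ h < M.H, ∃ s a₀ a, M.IsOptAction h s a₀ ∧ ¬ M.IsOptAction h s a ∧
    g = M.optQ h s a₀ - M.optQ h s a}

omit [Nonempty A] in
lemma gap_eq_sInf (M : TabularMDP S A) : M.gap = sInf M.gapSet := rfl

omit [Nonempty A] in
lemma finite_gapSet [Finite A] (M : TabularMDP S A) : M.gapSet.Finite := by
  refine (Set.finite_range fun p : Fin M.H × S × A × A =>
    M.optQ p.1 p.2.1 p.2.2.1 - M.optQ p.1 p.2.1 p.2.2.2).subset ?_
  rintro _ ⟨h, hh, s, a₀, a, -, -, rfl⟩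
  exact ⟨(⟨h, hh⟩, s, a₀, a), rfl⟩

omit [Nonempty A] in
lemma pos_of_mem_gapSet (M : TabularMDP S A) {g : ℝ} (hg : g ∈ M.gapSet) : 0 < g := by
  obtain ⟨h, hh, s, a₀, a, h0, h1, rfl⟩ := hg
  rw [IsOptAction, not_forall] at h1
  obtain ⟨b, hb⟩ := h1
  linarith [h0 b, not_le.1 hb]

lemma gap_le_optValue_sub [Finite A] (M : TabularMDP S A) {h : ℕ} (hh : h < M.H) {s : S} {a : A}
    (ha : ¬ M.IsOptAction h s a) : M.gap ≤ M.optValue h s - M.optQ h s a := by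
  obtain ⟨b, hb⟩ := M.exists_isOptAction h s
  rw [M.optValue_eq_optQ hh hb]
  exact csInf_le M.finite_gapSet.bddBelow ⟨h, hh, s, b, a, hb, ha, rfl⟩

omit [Nonempty A] in
lemma gap_pos [Finite A] (M : TabularMDP S A) (hM : M.gapSet.Nonempty) : 0 < M.gap :=
  M.pos_of_mem_gapSet (hM.csInf_mem M.finite_gapSet)

lemma gap_le_horizon [Finite A] (M : TabularMDP S A) (hM : M.gapSet.Nonempty) :
    M.gap ≤ M.H := by
  obtain ⟨h, hh, s, a₀, a, h0, h1, e⟩ := hM.csInf_mem M.finite_gapSet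
  rw [gap_eq_sInf, e]
  have := M.optQ_le_optValue hh s a₀
  have h2 := (M.optValue_mem hh.le s).2
  have := M.optQ_nonneg hh s a
  have : (0 : ℝ) ≤ h := h.cast_nonneg
  linarith

/-- With a single state, actions differ only in their immediate reward. This offsets the weaker
lower bound on the bonus width when `S = 1` in the baseline estimate. -/
lemma gap_le_one [Finite A] (M : TabularMDP S A) (hM : M.gapSet.Nonempty)
    (hS : Fintype.card S = 1) : M.gap ≤ 1 := by
  obtain ⟨h, hh, s, a₀, a, h0, h1, e⟩ := hM.csInf_mem M.finite_gapSet
  have key : ∑ s', M.P h s a₀ s' * M.optValue (h + 1) s' =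
      ∑ s', M.P h s a s' * M.optValue (h + 1) s' := by
    rcases (Nat.succ_le_of_lt hh).lt_or_eq with h1 | h1
    · have : Subsingleton S := Fintype.card_le_one_iff_subsingleton.1 hS.le
      simp only [Subsingleton.elim _ s, ← Finset.sum_mul]
      have e1 := (M.P_mem h h1 s a₀).2
      have e2 := (M.P_mem h h1 s a).2
      simp only [Subsingleton.elim _ s] at e1 e2
      rw [e1, e2]
    · simp [show h + 1 = M.H from h1, M.optValue_horizon]
  rw [gap_eq_sInf, e, optQ, optQ, key]
  linarith [(M.r_mem h hh s a₀).2, (M.r_mem h hh s a).1]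

end Values

end TabularMDP

/-- The episode-dependent quantity `κ_k` in the bonus. -/
def BonusKind.scale (β : BonusKind) (K k : ℕ) : ℝ :=
  match β with
  | .kDependent => K
  | .kIndependent => k + 1

namespace TabularMDP

/-! ### Visit counts and empirical kernels. -/

section Counting

variable {S A : Type*} [DecidableEq S] [DecidableEq A]

lemma visits_succ (x : ℕ → ℕ → S) (u : ℕ → ℕ → A) (k h : ℕ) (s : S) (a : A) :
    visits x u (k + 1) h s a = visits x u k h s a + if x k h = s ∧ u k h = a then 1 else 0 := by
  unfold visits
  rw [Finset.range_add_one, Finset.filter_insert]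
  split_ifs <;> simp

lemma transitions_succ (x : ℕ → ℕ → S) (u : ℕ → ℕ → A) (k h : ℕ) (s : S) (a : A) (s' : S) :
    transitions x u (k + 1) h s a s' = transitions x u k h s a s' +
      if x k h = s ∧ u k h = a ∧ x k (h + 1) = s' then 1 else 0 := by
  unfold transitions
  rw [Finset.range_add_one, Finset.filter_insert]
  split_ifs <;> simp

lemma visits_mono (x : ℕ → ℕ → S) (u : ℕ → ℕ → A) (h : ℕ) (s : S) (a : A) :
    Monotone fun k => visits x u k h s a :=
  monotone_nat_of_le_succ fun k => by rw [visits_succ]; exact Nat.le_add_right _ _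

lemma visits_le (x : ℕ → ℕ → S) (u : ℕ → ℕ → A) (k h : ℕ) (s : S) (a : A) :
    visits x u k h s a ≤ k :=
  (Finset.card_filter_le _ _).trans (Finset.card_range k).le

/-- Successive visits to a fixed pair see the counts `0, 1, 2, …`, each exactly once. -/
lemma sum_visits [Fintype S] [Fintype A] (x : ℕ → ℕ → S) (u : ℕ → ℕ → A) (h : ℕ) (f : ℕ → ℝ)
    (K : ℕ) :
    ∑ k ∈ Finset.range K, f (visits x u k h (x k h) (u k h)) =
      ∑ s, ∑ a, ∑ n ∈ Finset.range (visits x u K h s a), f n := by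
  induction K with
  | zero => simp [visits]
  | succ K ih =>
    have : ∀ s a, ∑ n ∈ Finset.range (visits x u (K + 1) h s a), f n =
        ∑ n ∈ Finset.range (visits x u K h s a), f n +
          if x K h = s then (if u K h = a then f (visits x u K h s a) else 0) else 0 := by
      intro s a
      rw [visits_succ]
      by_cases h1 : x K h = s <;> by_cases h2 : u K h = a <;>
        simp [h1, h2, Finset.sum_range_succ]
    simp only [Finset.sum_range_succ, ih, this, Finset.sum_add_distrib]
    simp

variable [Fintype S]

lemma sum_transitions (x : ℕ → ℕ → S) (u : ℕ → ℕ → A) (k h : ℕ) (s : S) (a : A) :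
    ∑ s', transitions x u k h s a s' = visits x u k h s a := by
  induction k with
  | zero => simp [visits, transitions]
  | succ k ih =>
    simp only [transitions_succ, visits_succ, Finset.sum_add_distrib, ih]
    by_cases h1 : x k h = s <;> by_cases h2 : u k h = a <;> simp [h1, h2]

lemma empP_nonneg (x : ℕ → ℕ → S) (u : ℕ → ℕ → A) (k h : ℕ) (s : S) (a : A) (s' : S) :
    0 ≤ empP x u k h s a s' := by
  unfold empP
  split_ifs <;> positivity

lemma sum_empP (x : ℕ → ℕ → S) (u : ℕ → ℕ → A) (k h : ℕ) (s : S) (a : A)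
    (hn : visits x u k h s a ≠ 0) : ∑ s', empP x u k h s a s' = 1 := by
  simp only [empP, if_neg hn, ← Finset.sum_div]
  rw [← Nat.cast_sum, sum_transitions, div_self (by exact_mod_cast hn)]

end Counting

/-- One-sided total variation bounds the difference of means of a function with values in
`[0, D]`. -/
lemma sum_sub_mul_le {S : Type*} [Fintype S] {p q V : S → ℝ} {t D : ℝ} (hD : 0 ≤ D)
    (h : ∀ B : Finset S, ∑ s ∈ B, (p s - q s) ≤ t) (hV : ∀ s, V s ∈ Set.Icc 0 D) :
    ∑ s, (p s - q s) * V s ≤ D * t := by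
  classical
  calc ∑ s, (p s - q s) * V s
      ≤ ∑ s, if q s < p s then D * (p s - q s) else 0 := by
        refine Finset.sum_le_sum fun s _ => ?_
        split_ifs with hs
        · rw [mul_comm]
          exact mul_le_mul_of_nonneg_right (hV s).2 (by linarith)
        · exact mul_nonpos_of_nonpos_of_nonneg (by linarith) (hV s).1
    _ = D * ∑ s ∈ Finset.univ.filter fun s => q s < p s, (p s - q s) := by
        rw [← Finset.sum_filter, Finset.mul_sum]
    _ ≤ D * t := mul_le_mul_of_nonneg_left (h _) hD

/-- Equal total masses turn an excess of `q` on `B` into an excess of `p` on the complement, so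
one-sided control over all subsets is two-sided. -/
lemma sum_sub_le_of_compl {S : Type*} [Fintype S] {p q : S → ℝ} {t : ℝ}
    (hpq : ∑ s, p s = ∑ s, q s) (h : ∀ B : Finset S, ∑ s ∈ B, (p s - q s) ≤ t) (B : Finset S) :
    ∑ s ∈ B, (q s - p s) ≤ t := by
  classical
  refine le_trans (le_of_eq ?_) (h Bᶜ)
  have e := Finset.sum_add_sum_compl B fun s => p s - q s
  rw [Finset.sum_sub_distrib (s := Finset.univ), hpq, sub_self] at e
  simp only [Finset.sum_sub_distrib] at e ⊢
  linarith

/-! ### Optimism of the planning step. -/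

section Planning

variable {S A : Type*} [Fintype S] [DecidableEq S] [DecidableEq A]

/-- The numerator under the square root of the bonus. -/
noncomputable def bonusWidth (S : Type*) [Fintype S] (μ α κ : ℝ) : ℝ :=
  0.5 * Fintype.card S * Real.log 2 + μ * κ ^ α

omit [DecidableEq S] [DecidableEq A] in
lemma bonus_of_ne_zero (M : TabularMDP S A) (β : BonusKind) (μ α : ℝ) (K k h : ℕ) {n : ℕ}
    (hn : n ≠ 0) : M.bonus β μ α K k h n =
      (((M.H : ℝ) - h - 1) * √(bonusWidth S μ α (β.scale K k) / n) : ℝ) := by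
  cases β <;> simp [bonus, hn, bonusWidth, BonusKind.scale]

variable (x : ℕ → ℕ → S) (u : ℕ → ℕ → A)

lemma planQ_of_unvisited (M : TabularMDP S A) (β : BonusKind) (μ α : ℝ) (K k h : ℕ) (s : S) (a : A)
    (hn : visits x u k h s a = 0) : M.planQ β μ α K x u k h s a = (M.H : ℝ) - h := by
  simp [planQ, backup, bonus, hn, -EReal.coe_sub]

lemma planQ_of_visited (M : TabularMDP S A) (β : BonusKind) (μ α : ℝ) (K k h : ℕ) (s : S) (a : A)
    (hn : visits x u k h s a ≠ 0) : M.planQ β μ α K x u k h s a =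
      min (M.r h s a + ∑ s', empP x u k h s a s' * M.planV β μ α K x u k (h + 1) s' +
        ((M.H : ℝ) - h - 1) * √(bonusWidth S μ α (β.scale K k) / visits x u k h s a))
        ((M.H : ℝ) - h) := by
  rw [planQ, backup, bonus_of_ne_zero _ _ _ _ _ _ _ hn, ← EReal.coe_add,
    ← EReal.coe_strictMono.monotone.map_min, EReal.toReal_coe]

lemma planQ_le (M : TabularMDP S A) (β : BonusKind) (μ α : ℝ) (K k h : ℕ) (s : S) (a : A) :
    M.planQ β μ α K x u k h s a ≤ (M.H : ℝ) - h := by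
  by_cases hn : visits x u k h s a = 0
  · exact (M.planQ_of_unvisited x u β μ α K k h s a hn).le
  · rw [M.planQ_of_visited x u β μ α K k h s a hn]
    exact min_le_right _ _

lemma planV_horizon (M : TabularMDP S A) (β : BonusKind) (μ α : ℝ) (K k : ℕ) (s : S) :
    M.planV β μ α K x u k M.H s = 0 := by
  simp [planV, planAux]

lemma planV_eq (M : TabularMDP S A) (β : BonusKind) (μ α : ℝ) (K k : ℕ) {h : ℕ} (hh : h < M.H)
    (s : S) : M.planV β μ α K x u k h s = ⨆ a, M.planQ β μ α K x u k h s a := by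
  obtain ⟨m, hm⟩ := Nat.exists_eq_add_of_lt hh
  have e1 : M.H - h = m + 1 := by omega
  have e2 : M.H - (h + 1) = m := by omega
  have e3 : M.H - (m + 1) = h := by omega
  rw [planV, e1, planAux, e3]
  simp only [planQ, planV, e2]

variable [Finite A] [Nonempty A]

omit [Nonempty A] in
lemma planQ_le_planV (M : TabularMDP S A) (β : BonusKind) (μ α : ℝ) (K k : ℕ) {h : ℕ}
    (hh : h < M.H) (s : S) (a : A) :
    M.planQ β μ α K x u k h s a ≤ M.planV β μ α K x u k h s := by
  rw [M.planV_eq x u β μ α K k hh]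
  exact le_ciSup (Set.finite_range _).bddAbove a

lemma planV_mem (M : TabularMDP S A) (β : BonusKind) (μ α : ℝ) (K k : ℕ) :
    ∀ h ≤ M.H, ∀ s, M.planV β μ α K x u k h s ∈ Set.Icc (0 : ℝ) ((M.H : ℝ) - h) := by
  refine M.stage_induction (fun s => by simp [planV_horizon]) fun h hh ih s => ⟨?_, ?_⟩
  · let a := Classical.arbitrary A
    have hH : (h : ℝ) + 1 ≤ M.H := by exact_mod_cast hh
    refine le_trans ?_ (M.planQ_le_planV x u β μ α K k hh s a)
    by_cases hn : visits x u k h s a = 0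
    · rw [M.planQ_of_unvisited x u β μ α K k h s a hn]
      linarith
    · rw [M.planQ_of_visited x u β μ α K k h s a hn]
      refine le_min (add_nonneg (add_nonneg (M.r_mem h hh s a).1 ?_) ?_) (by linarith)
      · exact Finset.sum_nonneg fun s' _ => mul_nonneg (empP_nonneg _ _ _ _ _ _ _) (ih s').1
      · exact mul_nonneg (by linarith) (Real.sqrt_nonneg _)
  · rw [M.planV_eq x u β μ α K k hh]
    exact ciSup_le fun a => M.planQ_le x u β μ α K k h s a

/-- The empirical kernels of episode `k` are close to the true ones, in total variation, at
confidence width `c`. -/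
def Concentrated (M : TabularMDP S A) (c : ℝ) (k : ℕ) : Prop :=
  ∀ h, h + 1 < M.H → ∀ s a, visits x u k h s a ≠ 0 → ∀ B : Finset S,
    ∑ s' ∈ B, (empP x u k h s a s' - M.P h s a s') ≤ √(c / visits x u k h s a)

variable {x u}

omit [Finite A] [Nonempty A] in
lemma Concentrated.mono {M : TabularMDP S A} {c c' : ℝ} {k : ℕ} (h : M.Concentrated x u c k)
    (hc : c ≤ c') : M.Concentrated x u c' k := fun t ht s a hn B =>
  (h t ht s a hn B).trans (by gcongr)

omit [Finite A] [Nonempty A] in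
lemma Concentrated.abs_sum_le {M : TabularMDP S A} {c : ℝ} {k : ℕ} (hc : M.Concentrated x u c k)
    {h : ℕ} (hh : h < M.H) {s : S} {a : A} (hn : visits x u k h s a ≠ 0) {V : S → ℝ}
    (hV : ∀ s', V s' ∈ Set.Icc (0 : ℝ) ((M.H : ℝ) - (h + 1 : ℕ))) :
    |∑ s', empP x u k h s a s' * V s' - ∑ s', M.P h s a s' * V s'| ≤
      ((M.H : ℝ) - h - 1) * √(c / visits x u k h s a) := by
  rcases (Nat.succ_le_of_lt hh).lt_or_eq with h1 | h1
  · have hD : (0 : ℝ) ≤ (M.H : ℝ) - h - 1 := by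
      have : ((h + 1 : ℕ) : ℝ) ≤ M.H := by exact_mod_cast h1.le
      push_cast at this
      linarith
    have hV' : ∀ s', V s' ∈ Set.Icc (0 : ℝ) ((M.H : ℝ) - h - 1) := by
      simpa [sub_sub] using hV
    have hs := (sum_empP x u k h s a hn).trans (M.P_mem h h1 s a).2.symm
    have e1 := sum_sub_mul_le hD (hc h h1 s a hn) hV'
    have e2 := sum_sub_mul_le hD (sum_sub_le_of_compl hs (hc h h1 s a hn)) hV'
    simp only [sub_mul, Finset.sum_sub_distrib] at e1 e2
    simp only [sub_mul] at e1 e2 ⊢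
    exact abs_le.2 ⟨by linarith, by linarith⟩
  -- At the last stage `V` takes values in `[0, 0]`, so no property of `M.P` is needed.
  · have hV0 : ∀ s', V s' = 0 := fun s' => by
      have := hV s'
      rw [show h + 1 = M.H from h1, sub_self] at this
      exact le_antisymm this.2 this.1
    have : (M.H : ℝ) - h - 1 = 0 := by rw [← h1]; push_cast; ring
    simp [hV0, this]

/-- Concentration is applied to the fixed function `V^*`; passing to the larger `V^k` uses only
nonnegativity of `empP`. -/
lemma Concentrated.optQ_le_planQ {M : TabularMDP S A} {β : BonusKind} {μ α : ℝ} {K k : ℕ}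
    (hc : M.Concentrated x u (bonusWidth S μ α (β.scale K k)) k) {h : ℕ} (hh : h < M.H)
    (hV : ∀ s, M.optValue (h + 1) s ≤ M.planV β μ α K x u k (h + 1) s) (s : S) (a : A) :
    M.optQ h s a ≤ M.planQ β μ α K x u k h s a := by
  have hle : M.optQ h s a ≤ (M.H : ℝ) - h :=
    (M.optQ_le_optValue hh s a).trans (M.optValue_mem hh.le s).2
  by_cases hn : visits x u k h s a = 0
  · rwa [M.planQ_of_unvisited x u β μ α K k h s a hn]
  · rw [M.planQ_of_visited x u β μ α K k h s a hn]
    refine le_min ?_ hle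
    have h1 := (abs_le.1 (hc.abs_sum_le hh hn (M.optValue_mem hh))).1
    have h2 : ∑ s', empP x u k h s a s' * M.optValue (h + 1) s' ≤
        ∑ s', empP x u k h s a s' * M.planV β μ α K x u k (h + 1) s' :=
      Finset.sum_le_sum fun s' _ =>
        mul_le_mul_of_nonneg_left (hV s') (empP_nonneg _ _ _ _ _ _ _)
    rw [optQ]
    linarith

/-- Optimism. -/
lemma Concentrated.optValue_le_planV {M : TabularMDP S A} {β : BonusKind} {μ α : ℝ} {K k : ℕ}
    (hc : M.Concentrated x u (bonusWidth S μ α (β.scale K k)) k) :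
    ∀ h ≤ M.H, ∀ s, M.optValue h s ≤ M.planV β μ α K x u k h s := by
  refine M.stage_induction (fun s => by rw [M.optValue_horizon, planV_horizon]) fun h hh ih s => ?_
  obtain ⟨a, ha⟩ := M.exists_isOptAction h s
  rw [M.optValue_eq_optQ hh ha]
  exact (hc.optQ_le_planQ hh ih s a).trans (M.planQ_le_planV x u β μ α K k hh s a)

/-- Here concentration is applied to `planV`, which depends on the data. Total variation control is
uniform over such functions, hence the union over subsets of states. -/
lemma Concentrated.planQ_le_add {M : TabularMDP S A} {β : BonusKind} {μ α : ℝ} {K k : ℕ}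
    (hc : M.Concentrated x u (bonusWidth S μ α (β.scale K k)) k) {h : ℕ} (hh : h < M.H)
    {s : S} {a : A} (hn : visits x u k h s a ≠ 0) :
    M.planQ β μ α K x u k h s a ≤
      M.r h s a + ∑ s', M.P h s a s' * M.planV β μ α K x u k (h + 1) s' + 2 *
        (((M.H : ℝ) - h - 1) * √(bonusWidth S μ α (β.scale K k) / visits x u k h s a)) := by
  rw [M.planQ_of_visited x u β μ α K k h s a hn]
  refine (min_le_left _ _).trans ?_
  have h1 := (abs_le.1 (hc.abs_sum_le hh hn (M.planV_mem x u β μ α K k (h + 1) hh))).2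
  linarith

end Planning

/-! ### Clipped surpluses and the gap. -/

section Clipping

variable {S A : Type*} [Fintype S] [DecidableEq S] [DecidableEq A]

/-- Backward recursion for `potential`. -/
noncomputable def potentialAux (M : TabularMDP S A) (b : ℕ → S → A → ℝ) (π : MarkovPolicy S A) :
    ℕ → S → ℝ
  | 0 => fun _ => 0
  | m + 1 => fun s =>
    let h := M.H - (m + 1)
    min ((m : ℝ) + 1)
      (b h s (π h s) + ∑ s', M.P h s (π h s) s' * potentialAux M b π m s')

/-- The expected sum of the costs `b` from stage `h` on under the policy `π`, truncated at each
stage at the number of remaining stages. -/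
noncomputable def potential (M : TabularMDP S A) (b : ℕ → S → A → ℝ) (π : MarkovPolicy S A)
    (h : ℕ) : S → ℝ :=
  M.potentialAux b π (M.H - h)

omit [DecidableEq S] [DecidableEq A] in
lemma potential_horizon (M : TabularMDP S A) (b : ℕ → S → A → ℝ) (π : MarkovPolicy S A) (s : S) :
    M.potential b π M.H s = 0 := by
  simp [potential, potentialAux]

omit [DecidableEq S] [DecidableEq A] in
lemma potential_eq (M : TabularMDP S A) (b : ℕ → S → A → ℝ) (π : MarkovPolicy S A) {h : ℕ}
    (hh : h < M.H) (s : S) : M.potential b π h s = min ((M.H : ℝ) - h)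
      (b h s (π h s) + ∑ s', M.P h s (π h s) s' * M.potential b π (h + 1) s') := by
  obtain ⟨m, hm⟩ := Nat.exists_eq_add_of_lt hh
  have e1 : M.H - h = m + 1 := by omega
  have e2 : M.H - (h + 1) = m := by omega
  have e3 : M.H - (m + 1) = h := by omega
  have e4 : (M.H : ℝ) - h = m + 1 := by rw [hm]; push_cast; ring
  rw [potential, e1, potentialAux, e3, e4]
  simp only [potential, e2]

omit [DecidableEq S] [DecidableEq A] in
lemma potential_mem (M : TabularMDP S A) {b : ℕ → S → A → ℝ} (hb : ∀ h < M.H, ∀ s a, 0 ≤ b h s a)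
    (π : MarkovPolicy S A) :
    ∀ h ≤ M.H, ∀ s, M.potential b π h s ∈ Set.Icc (0 : ℝ) ((M.H : ℝ) - h) := by
  refine M.stage_induction (fun s => by simp [potential_horizon]) fun h hh ih s => ?_
  have hH : (h : ℝ) ≤ M.H := by exact_mod_cast hh.le
  rw [M.potential_eq b π hh]
  refine ⟨le_min (by linarith) (add_nonneg (hb h hh _ _) ?_), min_le_left _ _⟩
  exact M.sum_P_mul_nonneg hh s _ (fun s' => (ih s').1) fun h1 s' => by
    rw [h1, potential_horizon]

/-- The clipping level at stage `h`. -/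
noncomputable def clip (M : TabularMDP S A) (h : ℕ) : ℝ :=
  if h + 1 < M.H then M.gap / (2 * ((M.H : ℝ) - 1)) else 0

/-- Sum of the clipping levels from stage `h` on. -/
noncomputable def clipSum (M : TabularMDP S A) (h : ℕ) : ℝ :=
  ((M.H - 1 - h : ℕ) : ℝ) * (M.gap / (2 * ((M.H : ℝ) - 1)))

omit [DecidableEq A] in
lemma clipSum_eq (M : TabularMDP S A) (h : ℕ) :
    M.clipSum h = M.clip h + M.clipSum (h + 1) := by
  unfold clipSum clip
  split_ifs with h1
  · rw [show M.H - 1 - h = M.H - 1 - (h + 1) + 1 by omega]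
    push_cast
    ring
  · rw [show M.H - 1 - h = 0 by omega, show M.H - 1 - (h + 1) = 0 by omega]
    simp

omit [DecidableEq A] in
lemma clipSum_horizon (M : TabularMDP S A) : M.clipSum M.H = 0 := by
  rw [clipSum, show M.H - 1 - M.H = 0 by omega]
  simp

omit [DecidableEq A] in
lemma clipSum_le (M : TabularMDP S A) (hH : 2 ≤ M.H) (hg : 0 ≤ M.gap) (h : ℕ) :
    M.clipSum h ≤ M.gap / 2 := by
  have h1 : (0 : ℝ) < (M.H : ℝ) - 1 := by
    have : (2 : ℝ) ≤ M.H := by exact_mod_cast hH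
    linarith
  have h2 : ((M.H - 1 - h : ℕ) : ℝ) ≤ (M.H : ℝ) - 1 := by
    rw [← Nat.cast_pred (by omega)]
    exact_mod_cast Nat.sub_le _ _
  calc M.clipSum h ≤ ((M.H : ℝ) - 1) * (M.gap / (2 * ((M.H : ℝ) - 1))) := by
        unfold clipSum
        gcongr
    _ = M.gap / 2 := by field_simp

omit [DecidableEq A] in
lemma clip_le_one (M : TabularMDP S A) (hH : 2 ≤ M.H) (hg : M.gap ≤ M.H) (h : ℕ) :
    M.clip h ≤ 1 := by
  have h1 : (2 : ℝ) ≤ M.H := by exact_mod_cast hH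
  unfold clip
  split_ifs
  · rw [div_le_one (by linarith)]
    linarith
  · exact zero_le_one

/-- The bound on the surplus after `n` visits, reduced by the clipping level. -/
noncomputable def clippedBonus (M : TabularMDP S A) (c : ℝ) (h n : ℕ) : ℝ :=
  if n = 0 then (M.H : ℝ) - h - M.clip h
  else max (2 * (((M.H : ℝ) - h - 1) * √(c / n)) - M.clip h) 0

omit [DecidableEq A] in
lemma clippedBonus_nonneg (M : TabularMDP S A) (hH : 2 ≤ M.H) (hg : M.gap ≤ M.H) (c : ℝ) {h : ℕ}
    (hh : h < M.H) (n : ℕ) : 0 ≤ M.clippedBonus c h n := by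
  unfold clippedBonus
  split_ifs
  · have : (h : ℝ) + 1 ≤ M.H := by exact_mod_cast hh
    linarith [M.clip_le_one hH hg h]
  · exact le_max_right _ _

variable [Finite A] [Nonempty A] {x : ℕ → ℕ → S} {u : ℕ → ℕ → A}

/-- Each stage adds at most one surplus to the optimistic error; the part below the clipping level
goes into `clipSum`, the rest into the potential. The common width `c` makes the charge depend on
the episode only through the visit counts. -/
lemma Concentrated.planV_sub_le_potential {M : TabularMDP S A} (hH : 2 ≤ M.H) (hg0 : 0 ≤ M.gap)
    (hg : M.gap ≤ M.H) {β : BonusKind} {μ α : ℝ} {K k : ℕ}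
    (hc : M.Concentrated x u (bonusWidth S μ α (β.scale K k)) k) {c : ℝ}
    (hle : bonusWidth S μ α (β.scale K k) ≤ c) {π : MarkovPolicy S A}
    (hπ : ∀ h < M.H, ∀ s a,
      M.planQ β μ α K x u k h s a ≤ M.planQ β μ α K x u k h s (π h s)) :
    ∀ h ≤ M.H, ∀ s, M.planV β μ α K x u k h s - M.value π h s - M.clipSum h ≤
      M.potential (fun h s a => M.clippedBonus c h (visits x u k h s a)) π h s := by
  set b : ℕ → S → A → ℝ := fun h s a => M.clippedBonus c h (visits x u k h s a) with hb
  have hb0 : ∀ h < M.H, ∀ s a, 0 ≤ b h s a := fun h hh s a => M.clippedBonus_nonneg hH hg c hh _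
  have hpot := M.potential_mem hb0 π
  refine M.stage_induction (fun s => ?_) fun h hh ih s => ?_
  · simp [planV_horizon, M.value_of_le, clipSum_horizon, potential_horizon]
  have hclip : 0 ≤ M.clipSum h :=
    mul_nonneg (Nat.cast_nonneg _) (div_nonneg hg0 (by
      have : (2 : ℝ) ≤ M.H := by exact_mod_cast hH
      linarith))
  have hV : M.planV β μ α K x u k h s = M.planQ β μ α K x u k h s (π h s) := by
    rw [M.planV_eq x u β μ α K k hh]
    exact le_antisymm (ciSup_le fun a => hπ h hh s a)
      (le_ciSup (Set.finite_range _).bddAbove (π h s))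
  have hval := (M.value_mem π h hh.le s).1
  rw [M.potential_eq b π hh]
  refine le_min ?_ ?_
  · linarith [(M.planV_mem x u β μ α K k h hh.le s).2]
  have hpot0 : 0 ≤ ∑ s', M.P h s (π h s) s' * M.potential b π (h + 1) s' :=
    M.sum_P_mul_nonneg hh s _ (fun s' => (hpot (h + 1) hh s').1) fun h1 s' => by
      rw [h1, potential_horizon]
  have hce := M.clipSum_eq h
  have hc1 : 0 ≤ M.clipSum (h + 1) :=
    mul_nonneg (Nat.cast_nonneg _) (div_nonneg hg0 (by
      have : (2 : ℝ) ≤ M.H := by exact_mod_cast hH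
      linarith))
  by_cases hn : visits x u k h s (π h s) = 0
  -- For an unvisited pair the cap `H - h` is exactly the charge plus the clipping level.
  · have : b h s (π h s) = (M.H : ℝ) - h - M.clip h := by simp [hb, clippedBonus, hn]
    rw [hV, M.planQ_of_unvisited x u β μ α K k h s _ hn, this]
    linarith
  · have hbn : 2 * (((M.H : ℝ) - h - 1) * √(c / visits x u k h s (π h s))) - M.clip h ≤
        b h s (π h s) := by
      simp [hb, clippedBonus, hn]
    have hw : ((M.H : ℝ) - h - 1) *
        √(bonusWidth S μ α (β.scale K k) / visits x u k h s (π h s)) ≤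
        ((M.H : ℝ) - h - 1) * √(c / visits x u k h s (π h s)) := by
      have : (h : ℝ) + 1 ≤ M.H := by exact_mod_cast hh
      refine mul_le_mul_of_nonneg_left ?_ (by linarith)
      gcongr
    have hQ := hc.planQ_le_add hh hn
    have hstep : ∑ s', M.P h s (π h s) s' * (M.planV β μ α K x u k (h + 1) s' -
        M.value π (h + 1) s' - M.potential b π (h + 1) s') ≤ M.clipSum (h + 1) := by
      rcases (Nat.succ_le_of_lt hh).lt_or_eq with h1 | h1
      · calc _ ≤ ∑ s', M.P h s (π h s) s' * M.clipSum (h + 1) :=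
              M.sum_P_mul_mono hh s _ (fun s' => by linarith [ih s']) fun h2 => by omega
          _ = M.clipSum (h + 1) := by
              rw [← Finset.sum_mul, (M.P_mem h h1 s _).2, one_mul]
      · rw [show h + 1 = M.H from h1] at hc1 ⊢
        simpa [planV_horizon, M.value_of_le, potential_horizon] using hc1
    simp only [mul_sub, Finset.sum_sub_distrib] at hstep
    rw [hV, M.value_eq π hh]
    linarith

/-- The potential dominates half of the suboptimality of the greedy policy. -/
lemma Concentrated.optValue_sub_le_potential {M : TabularMDP S A} (hH : 2 ≤ M.H)
    (hg0 : 0 ≤ M.gap) (hg : M.gap ≤ M.H) {β : BonusKind} {μ α : ℝ} {K k : ℕ}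
    (hc : M.Concentrated x u (bonusWidth S μ α (β.scale K k)) k) {c : ℝ}
    (hle : bonusWidth S μ α (β.scale K k) ≤ c) {π : MarkovPolicy S A}
    (hπ : ∀ h < M.H, ∀ s a,
      M.planQ β μ α K x u k h s a ≤ M.planQ β μ α K x u k h s (π h s)) :
    ∀ h ≤ M.H, ∀ s, M.optValue h s - M.value π h s ≤
      2 * M.potential (fun h s a => M.clippedBonus c h (visits x u k h s a)) π h s := by
  have hA := hc.planV_sub_le_potential hH hg0 hg hle hπ
  set b : ℕ → S → A → ℝ := fun h s a => M.clippedBonus c h (visits x u k h s a) with hb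
  have hb0 : ∀ h < M.H, ∀ s a, 0 ≤ b h s a := fun h hh s a => M.clippedBonus_nonneg hH hg c hh _
  refine M.stage_induction (fun s => ?_) fun h hh ih s => ?_
  · simp [M.value_of_le, optValue_horizon, potential_horizon]
  -- An optimal action loses nothing now: the suboptimality is the mean of the next-stage one.
  by_cases ho : M.IsOptAction h s (π h s)
  · have h1 : M.optValue h s - M.value π h s = ∑ s', M.P h s (π h s) s' *
        (M.optValue (h + 1) s' - M.value π (h + 1) s') := by
      rw [M.optValue_eq_optQ hh ho, M.value_eq π hh, optQ]
      simp only [mul_sub, Finset.sum_sub_distrib]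
      ring
    have h2 : M.optValue h s - M.value π h s ≤
        2 * ∑ s', M.P h s (π h s) s' * M.potential b π (h + 1) s' := by
      rw [h1, Finset.mul_sum]
      refine (M.sum_P_mul_mono hh s _ ih fun h2 s' => ?_).trans (le_of_eq ?_)
      · rw [h2]
        simp [M.value_of_le, optValue_horizon, potential_horizon]
      · exact Finset.sum_congr rfl fun s' _ => by ring
    have h3 := (M.optValue_mem hh.le s).2
    have h4 := (M.value_mem π h hh.le s).1
    have h5 := (M.value_mem π h hh.le s).2
    rw [M.potential_eq b π hh, mul_min_of_nonneg _ _ zero_le_two]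
    exact le_min (by linarith) (by linarith [hb0 h hh s (π h s)])
  -- A suboptimal action loses at least the gap, hence at least twice `clipSum`; the clipping is
  -- absorbed by half of the suboptimality.
  · have h1 := M.gap_le_optValue_sub hh ho
    have h2 := M.value_le_optQ π hh s
    have h3 := M.clipSum_le hH hg0 h
    have h4 := hA h hh.le s
    have h5 := hc.optValue_le_planV h hh.le s
    linarith

end Clipping

end TabularMDP

/-! ### Deterministic bound on the collected bonuses. -/

namespace TabularMDP

lemma sum_inv_sqrt_le (N : ℕ) :
    ∑ n ∈ Finset.range N, 1 / √((n : ℝ) + 1) ≤ 2 * √(N : ℝ) := by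
  induction N with
  | zero => simp
  | succ N ih =>
    rw [Finset.sum_range_succ]
    have h0 : (0 : ℝ) ≤ N := N.cast_nonneg
    have h1 : 0 < √((N : ℝ) + 1) := Real.sqrt_pos.2 (by linarith)
    have h2 := Real.sq_sqrt (show (0 : ℝ) ≤ (N : ℝ) + 1 by linarith)
    have h3 := Real.sq_sqrt h0
    have h4 : 1 / √((N : ℝ) + 1) ≤ 2 * √((N : ℝ) + 1) - 2 * √(N : ℝ) := by
      rw [div_le_iff₀ h1]
      nlinarith [sq_nonneg (√((N : ℝ) + 1) - √(N : ℝ))]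
    push_cast
    linarith

/-- The summands decrease, so if the last one is positive none is clipped. The sum over `m` terms is
then at most `2 C √m - m ε`, and completing the square gives `C² / ε`. -/
lemma sum_clipped_inv_sqrt_le {C ε : ℝ} (hC : 0 ≤ C) (hε : 0 < ε) (N : ℕ) :
    ∑ n ∈ Finset.range N, max (C / √((n : ℝ) + 1) - ε) 0 ≤ C ^ 2 / ε := by
  induction N with
  | zero => simpa using by positivity
  | succ N ih =>
    by_cases hN : C / √((N : ℝ) + 1) - ε ≤ 0
    · rwa [Finset.sum_range_succ, max_eq_right hN, add_zero]
    · have h1 : ∀ n ∈ Finset.range (N + 1), max (C / √((n : ℝ) + 1) - ε) 0 =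
          C * (1 / √((n : ℝ) + 1)) - ε := by
        intro n hn
        have hn' : (n : ℝ) ≤ N := by exact_mod_cast Finset.mem_range_succ_iff.1 hn
        have hn0 : (0 : ℝ) < (n : ℝ) + 1 := by positivity
        have : C / √((N : ℝ) + 1) ≤ C / √((n : ℝ) + 1) := by gcongr
        rw [max_eq_left (by linarith), mul_one_div]
      rw [Finset.sum_congr rfl h1, Finset.sum_sub_distrib, ← Finset.mul_sum, Finset.sum_const,
        Finset.card_range, nsmul_eq_mul]
      have h2 := mul_le_mul_of_nonneg_left (sum_inv_sqrt_le (N + 1)) hC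
      have h3 : (0 : ℝ) ≤ ((N + 1 : ℕ) : ℝ) := Nat.cast_nonneg _
      set m : ℝ := ((N + 1 : ℕ) : ℝ)
      have h4 := Real.sq_sqrt h3
      rw [le_div_iff₀ hε]
      have h5 : C * (2 * √m) * ε - m * ε * ε ≤ C ^ 2 := by
        have h6 : (C - ε * √m) ^ 2 = C ^ 2 - C * (2 * √m) * ε + √m ^ 2 * ε * ε := by ring
        rw [h4] at h6
        linarith [sq_nonneg (C - ε * √m)]
      linarith [mul_le_mul_of_nonneg_right h2 hε.le]

lemma sum_range_sub_sq (p : ℕ) :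
    ∑ h ∈ Finset.range p, ((p : ℝ) - h) ^ 2 = (p : ℝ) * (p + 1) * (2 * p + 1) / 6 := by
  induction p with
  | zero => simp
  | succ p ih =>
    rw [Finset.sum_range_succ']
    push_cast
    simp only [add_sub_add_right_eq_sub, ih]
    ring

lemma sum_range_sub (p : ℕ) :
    ∑ h ∈ Finset.range p, ((p : ℝ) - h) = (p : ℝ) * (p + 1) / 2 := by
  induction p with
  | zero => simp
  | succ p ih =>
    rw [Finset.sum_range_succ']
    push_cast
    simp only [add_sub_add_right_eq_sub, ih]
    ring

variable {S A : Type*} [Fintype S] [DecidableEq S]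

/-- The first visit is charged separately. Later visits fall under `sum_clipped_inv_sqrt_le` with `C
= 2 (H - h - 1) √c` and `ε = gap / (2 (H - 1))`; at the last stage the bonus vanishes. -/
lemma sum_clippedBonus_le (M : TabularMDP S A) (hH : 2 ≤ M.H) (hg0 : 0 < M.gap)
    (hg : M.gap ≤ M.H) {c : ℝ} (hc : 0 ≤ c) {h : ℕ} (hh : h < M.H) (N : ℕ) :
    ∑ n ∈ Finset.range N, M.clippedBonus c h n ≤ ((M.H : ℝ) - h - M.clip h) +
      8 * ((M.H : ℝ) - 1) * c / M.gap * ((M.H : ℝ) - 1 - h) ^ 2 := by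
  have hH' : (2 : ℝ) ≤ M.H := by exact_mod_cast hH
  have hh' : (h : ℝ) + 1 ≤ M.H := by exact_mod_cast hh
  have hR : 0 ≤ 8 * ((M.H : ℝ) - 1) * c / M.gap * ((M.H : ℝ) - 1 - h) ^ 2 :=
    mul_nonneg (div_nonneg (mul_nonneg (by linarith) hc) hg0.le) (sq_nonneg _)
  cases N with
  | zero =>
    simp only [Finset.range_zero, Finset.sum_empty]
    linarith [M.clip_le_one hH hg h]
  | succ N =>
    rw [Finset.sum_range_succ', add_comm]
    refine add_le_add (by simp [clippedBonus]) ?_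
    rcases (Nat.succ_le_of_lt hh).lt_or_eq with h1 | h1
    · have hclip : M.clip h = M.gap / (2 * ((M.H : ℝ) - 1)) := if_pos h1
      have hpos : 0 < M.clip h := by
        rw [hclip]
        exact div_pos hg0 (by linarith)
      have hD : 0 ≤ 2 * ((M.H : ℝ) - h - 1) * √c :=
        mul_nonneg (by linarith) (Real.sqrt_nonneg c)
      refine le_trans (le_of_eq (Finset.sum_congr rfl fun n _ => ?_))
        ((sum_clipped_inv_sqrt_le hD hpos N).trans (le_of_eq ?_))
      · rw [clippedBonus, if_neg n.succ_ne_zero, Real.sqrt_div hc]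
        push_cast
        ring_nf
      · rw [mul_pow, Real.sq_sqrt hc, hclip]
        have : (M.H : ℝ) - 1 ≠ 0 := by linarith
        field_simp
        ring
    · have e : (M.H : ℝ) - h - 1 = 0 := by rw [← h1]; push_cast; ring
      refine le_trans (le_of_eq ?_) hR
      refine Finset.sum_eq_zero fun n _ => ?_
      rw [clippedBonus, if_neg n.succ_ne_zero, e, clip, if_neg (by omega)]
      simp

lemma sum_clip (M : TabularMDP S A) (hH : 2 ≤ M.H) :
    ∑ h ∈ Finset.range M.H, M.clip h = M.gap / 2 := by
  obtain ⟨p, hp⟩ : ∃ p, M.H = p + 1 := ⟨M.H - 1, by omega⟩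
  have hp1 : (p : ℝ) ≠ 0 := by
    have : p ≠ 0 := by omega
    exact_mod_cast this
  rw [hp, Finset.sum_range_succ, Finset.sum_congr rfl fun h hh => by
    rw [clip, if_pos (by rw [hp]; have := Finset.mem_range.1 hh; omega)]]
  rw [Finset.sum_const, Finset.card_range, clip, if_neg (by omega), hp]
  push_cast
  rw [nsmul_eq_mul, add_sub_cancel_right]
  field_simp
  ring

/-- The clipped bonuses collected along any data sequence stay below the baseline. -/
lemma sum_clippedBonus_visits_le [Fintype A] [DecidableEq A] [Nonempty A] (M : TabularMDP S A)
    (hH : 2 ≤ M.H) (hM : M.gapSet.Nonempty) {μ α : ℝ} (hμ : 0 < μ) (K : ℕ) (x : ℕ → ℕ → S)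
    (u : ℕ → ℕ → A) :
    2 * ∑ h ∈ Finset.range M.H, ∑ k ∈ Finset.range K,
      M.clippedBonus (bonusWidth S μ α K) h (visits x u k h (x k h) (u k h)) ≤
        M.baseline μ α K := by
  have hg0 := M.gap_pos hM
  have hg := M.gap_le_horizon hM
  have hH' : (2 : ℝ) ≤ M.H := by exact_mod_cast hH
  have hK : 0 ≤ μ * (K : ℝ) ^ α := by positivity
  have hl : (0.69 : ℝ) ≤ Real.log 2 := by linarith [Real.log_two_gt_d9]
  have hc : 0.5 * Fintype.card S * Real.log 2 ≤ bonusWidth S μ α K := by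
    unfold bonusWidth; linarith
  have hc0 : 0 ≤ bonusWidth S μ α K := le_trans (by positivity) hc
  have hS : 1 ≤ Fintype.card S := Fintype.card_pos_iff.2 ⟨M.s₀⟩
  have hbase : M.baseline μ α K = Fintype.card S * Fintype.card A *
      (8 / 3 * bonusWidth S μ α K * (M.H : ℝ) ^ 2 * ((M.H : ℝ) - 1) * (2 * M.H - 1) / M.gap) := by
    unfold baseline bonusWidth
    field_simp
    ring
  set c := bonusWidth S μ α K
  have hsum : ∑ h ∈ Finset.range M.H, (((M.H : ℝ) - h - M.clip h) +
      8 * ((M.H : ℝ) - 1) * c / M.gap * ((M.H : ℝ) - 1 - h) ^ 2) =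
      (M.H : ℝ) * (M.H + 1) / 2 - M.gap / 2 + 8 * ((M.H : ℝ) - 1) * c / M.gap *
        (((M.H : ℝ) - 1) * M.H * (2 * M.H - 1) / 6) := by
    rw [Finset.sum_add_distrib, Finset.sum_sub_distrib, M.sum_clip hH, sum_range_sub,
      ← Finset.mul_sum]
    congr 2
    obtain ⟨p, hp⟩ : ∃ p, M.H = p + 1 := ⟨M.H - 1, by omega⟩
    rw [hp, Finset.sum_range_succ]
    push_cast
    have := sum_range_sub_sq p
    simp only [add_sub_cancel_right, this]
    ring
  -- The later visits contribute a factor `H (H - 1)²` where `baseline` has `H² (H - 1)`. The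
  -- difference `H (H - 1)` must absorb the first-visit cost `H (H + 1) - gap`.
  have harith : (M.H : ℝ) * (M.H + 1) - M.gap ≤
      8 / 3 * c * M.H * ((M.H : ℝ) - 1) * (2 * M.H - 1) / M.gap := by
    rw [le_div_iff₀ hg0]
    have hq : 0 ≤ (M.H : ℝ) * ((M.H : ℝ) - 1) * (2 * M.H - 1) :=
      mul_nonneg (mul_nonneg (by linarith) (by linarith)) (by linarith)
    -- The width is at least `S ln 2 / 2`: about `0.345` for `S = 1`, where `gap ≤ 1`, and at least
    -- `0.69` for `S ≥ 2`, where `gap ≤ H` suffices.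
    rcases hS.eq_or_lt with h1 | h1
    · have hg1 := M.gap_le_one hM h1.symm
      have hc1 : 0.345 ≤ c := by
        refine le_trans ?_ hc
        rw [← h1]
        push_cast
        linarith
      have h2 := mul_le_mul_of_nonneg_right hc1 hq
      have h3 : ((M.H : ℝ) * (M.H + 1) - M.gap) * M.gap ≤ (M.H : ℝ) * (M.H + 1) - 1 := by
        nlinarith [mul_nonneg (sub_nonneg.2 hg1)
          (show 0 ≤ (M.H : ℝ) * (M.H + 1) - 1 - M.gap by nlinarith)]
      have h4 : (M.H : ℝ) * (M.H + 1) - 1 ≤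
          8 / 3 * 0.345 * (M.H * ((M.H : ℝ) - 1) * (2 * M.H - 1)) := by
        linarith [mul_nonneg (sub_nonneg.2 hH') (sub_nonneg.2 hH'),
          mul_nonneg (mul_nonneg (sub_nonneg.2 hH') (sub_nonneg.2 hH')) (sub_nonneg.2 hH')]
      linarith
    · have hc1 : 0.69 ≤ c := by
        refine le_trans ?_ hc
        have : (2 : ℝ) ≤ Fintype.card S := by exact_mod_cast h1
        nlinarith
      have h2 := mul_le_mul_of_nonneg_right hc1 hq
      have h3 : ((M.H : ℝ) * (M.H + 1) - M.gap) * M.gap ≤ (M.H : ℝ) * M.H * M.H := by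
        nlinarith [mul_nonneg (sub_nonneg.2 hg)
          (show 0 ≤ (M.H : ℝ) * M.H - M.gap by nlinarith)]
      have h4 : (M.H : ℝ) * M.H * M.H ≤
          8 / 3 * 0.69 * (M.H * ((M.H : ℝ) - 1) * (2 * M.H - 1)) := by
        linarith [mul_nonneg (sub_nonneg.2 hH') (sub_nonneg.2 hH'),
          mul_nonneg (mul_nonneg (sub_nonneg.2 hH') (sub_nonneg.2 hH')) (sub_nonneg.2 hH')]
      linarith
  calc 2 * ∑ h ∈ Finset.range M.H, ∑ k ∈ Finset.range K,
        M.clippedBonus c h (visits x u k h (x k h) (u k h))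
      ≤ 2 * ∑ h ∈ Finset.range M.H, Fintype.card S * Fintype.card A *
          (((M.H : ℝ) - h - M.clip h) +
            8 * ((M.H : ℝ) - 1) * c / M.gap * ((M.H : ℝ) - 1 - h) ^ 2) := by
        refine mul_le_mul_of_nonneg_left (Finset.sum_le_sum fun h hh => ?_) zero_le_two
        rw [sum_visits]
        refine (Finset.sum_le_sum fun s _ => Finset.sum_le_sum fun a _ =>
          M.sum_clippedBonus_le hH hg0 hg hc0 (Finset.mem_range.1 hh) _).trans (le_of_eq ?_)
        simp only [Finset.sum_const, Finset.card_univ, nsmul_eq_mul, mul_assoc]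
    _ = Fintype.card S * Fintype.card A * (((M.H : ℝ) * (M.H + 1) - M.gap) +
          8 / 3 * c * M.H * ((M.H : ℝ) - 1) * ((M.H : ℝ) - 1) * (2 * M.H - 1) / M.gap) := by
        rw [← Finset.mul_sum, hsum]
        field_simp
        ring
    _ ≤ Fintype.card S * Fintype.card A *
          (8 / 3 * c * M.H * ((M.H : ℝ) - 1) * (2 * M.H - 1) / M.gap +
          8 / 3 * c * M.H * ((M.H : ℝ) - 1) * ((M.H : ℝ) - 1) * (2 * M.H - 1) / M.gap) := by
        gcongr
    _ = M.baseline μ α K := by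
        rw [hbase]
        ring

end TabularMDP

/-- Hoeffding's lemma on a finite type. -/
lemma sum_mul_exp_sub_mean_le {S : Type*} [Fintype S] {p f : S → ℝ} {a b : ℝ}
    (hp : p ∈ stdSimplex ℝ S) (hf : ∀ s, f s ∈ Set.Icc a b) (t : ℝ) :
    ∑ s, p s * Real.exp (t * (f s - ∑ s', p s' * f s')) ≤
      Real.exp (t ^ 2 * (b - a) ^ 2 / 8) := by
  let _ : MeasurableSpace S := ⊤
  have hsum : ∑ s, ENNReal.ofReal (p s) = 1 := by
    rw [← ENNReal.ofReal_sum_of_nonneg fun s _ => hp.1 s, hp.2, ENNReal.ofReal_one]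
  let q : PMF S := PMF.ofFintype _ hsum
  have hq : ∀ g : S → ℝ, ∫ s, g s ∂q.toMeasure = ∑ s, p s * g s := fun g => by
    rw [PMF.integral_eq_sum]
    simp [q, ENNReal.toReal_ofReal (hp.1 _)]
  have key := (hasSubgaussianMGF_of_mem_Icc (μ := q.toMeasure) (X := f)
    (measurable_of_finite f).aemeasurable (Filter.Eventually.of_forall hf)).mgf_le t
  rw [mgf, hq, hq] at key
  refine key.trans (le_of_eq ?_)
  congr 1
  push_cast
  rw [div_pow, Real.norm_eq_abs, sq_abs]
  ring

/-! ### Exponential supermartingales. -/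

section

variable {Ω : Type*}

/-- States and actions carry no σ-algebra; measurability of the fibres replaces it. -/
lemma measurable_apply_of_fiber {ι : Type*} [Finite ι] {m : MeasurableSpace Ω} {φ : Ω → ι}
    (hφ : ∀ i, MeasurableSet {ω | φ ω = i}) {G : ι → Ω → ℝ} (hG : ∀ i, Measurable (G i)) :
    Measurable fun ω => G (φ ω) ω := by
  classical
  have := Fintype.ofFinite ι
  have : (fun ω => G (φ ω) ω) = fun ω => ∑ i, {ω | φ ω = i}.indicator (G i) ω := by
    ext ω
    simp [Set.indicator_apply]
  rw [this]
  exact Finset.measurable_sum _ fun i _ => (hG i).indicator (hφ i)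

variable {m₀ : MeasurableSpace Ω} {Pr : Measure Ω}

lemma integrable_of_abs_le [IsFiniteMeasure Pr] {f : Ω → ℝ} (hf : Measurable f) {C : ℝ}
    (hC : ∀ ω, |f ω| ≤ C) : Integrable f Pr :=
  .of_bound hf.aestronglyMeasurable C (Filter.Eventually.of_forall hC)

/-- If `g` has conditional mean at most one along the conditional law `p` of `X`, multiplying by
`g X` does not increase integrals of nonnegative functions of the past. -/
lemma integral_mul_apply_le [IsFiniteMeasure Pr] {S : Type*} [Fintype S] {m : MeasurableSpace Ω}
    (hm : m ≤ m₀) {X : Ω → S} (hX : ∀ s, MeasurableSet[m₀] {ω | X ω = s}) {p : S → Ω → ℝ}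
    (hp : ∀ s, Pr[{ω | X ω = s}.indicator (fun _ => (1 : ℝ)) | m] =ᵐ[Pr] p s)
    {Z : Ω → ℝ} (hZ : Measurable[m] Z) (hZ0 : ∀ ω, 0 ≤ Z ω) {C : ℝ} (hZC : ∀ ω, Z ω ≤ C)
    {g : S → Ω → ℝ} (hg : ∀ s, Measurable[m] (g s)) {D : ℝ} (hgD : ∀ s ω, |g s ω| ≤ D)
    (hsum : ∀ ω, ∑ s, p s ω * g s ω ≤ 1) :
    ∫ ω, Z ω * g (X ω) ω ∂Pr ≤ ∫ ω, Z ω ∂Pr := by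
  classical
  have hCa : ∀ ω, |Z ω| ≤ C := fun ω => by rw [abs_of_nonneg (hZ0 ω)]; exact hZC ω
  have hmul : ∀ s, Measurable[m] (Z * g s) := fun s => hZ.mul (hg s)
  have hone : ∀ s, Measurable[m₀] ({ω | X ω = s}.indicator (fun _ => (1 : ℝ))) := fun s =>
    measurable_const.indicator (hX s)
  have hbd : ∀ s ω, |(Z * g s) ω| ≤ C * D := fun s ω => by
    rw [Pi.mul_apply, abs_mul]
    exact mul_le_mul (hCa ω) (hgD s ω) (abs_nonneg _) ((abs_nonneg _).trans (hCa ω))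
  have hind : ∀ s ω, |{ω | X ω = s}.indicator (fun _ => (1 : ℝ)) ω| ≤ 1 := fun s ω => by
    by_cases h : X ω = s <;> simp [h]
  have hi1 : ∀ s, Integrable ({ω | X ω = s}.indicator (fun _ => (1 : ℝ))) Pr := fun s =>
    integrable_of_abs_le (hone s) (hind s)
  have hi : ∀ s, Integrable ((Z * g s) * {ω | X ω = s}.indicator (fun _ => (1 : ℝ))) Pr :=
    fun s => integrable_of_abs_le (((hmul s).mono hm le_rfl).mul (hone s)) (C := C * D) fun ω => by
      rw [Pi.mul_apply, abs_mul]
      exact (mul_le_of_le_one_right (abs_nonneg _) (hind s ω)).trans (hbd s ω)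
  have hce : ∀ s, Pr[(Z * g s) * {ω | X ω = s}.indicator (fun _ => (1 : ℝ)) | m] =ᵐ[Pr]
      (Z * g s) * p s := fun s => by
    refine (condExp_mul_of_stronglyMeasurable_left (hmul s).stronglyMeasurable (hi s)
      (hi1 s)).trans ?_
    filter_upwards [hp s] with ω hω
    simp [hω]
  -- No bound on `p` is assumed; integrability is inherited from the conditional expectation.
  have hpi : ∀ s, Integrable ((Z * g s) * p s) Pr := fun s =>
    integrable_condExp.congr (hce s)
  calc ∫ ω, Z ω * g (X ω) ω ∂Pr
      = ∫ ω, ∑ s, ((Z * g s) * {ω | X ω = s}.indicator (fun _ => (1 : ℝ))) ω ∂Pr := by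
        refine integral_congr_ae (Filter.Eventually.of_forall fun ω => ?_)
        simp [Set.indicator_apply]
    _ = ∑ s, ∫ ω, ((Z * g s) * p s) ω ∂Pr := by
        rw [integral_finsetSum _ fun s _ => hi s]
        exact Finset.sum_congr rfl fun s _ =>
          (integral_condExp hm).symm.trans (integral_congr_ae (hce s))
    _ = ∫ ω, ∑ s, ((Z * g s) * p s) ω ∂Pr := (integral_finsetSum _ fun s _ => hpi s).symm
    _ ≤ ∫ ω, Z ω ∂Pr := by
        refine integral_mono (integrable_finsetSum _ fun s _ => hpi s)
          (integrable_of_abs_le (hZ.mono hm le_rfl) hCa) fun ω => ?_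
        have e : ∑ s, ((Z * g s) * p s) ω = Z ω * ∑ s, p s ω * g s ω := by
          rw [Finset.mul_sum]
          exact Finset.sum_congr rfl fun s _ => by simp only [Pi.mul_apply]; ring
        rw [e]
        exact mul_le_of_le_one_right (hZ0 ω) (hsum ω)

/-- Increments `Y i` with conditional exponential moments at most one. -/
lemma integral_exp_sum_le_one [IsProbabilityMeasure Pr] {𝒢 : ℕ → MeasurableSpace Ω}
    (h𝒢 : Monotone 𝒢) {Y : ℕ → Ω → ℝ} {T : ℕ} (hY : ∀ i < T, Measurable[𝒢 (i + 1)] (Y i))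
    {C : ℝ} (hC : ∀ i < T, ∀ ω, |Y i ω| ≤ C)
    (hstep : ∀ i < T, ∀ Z : Ω → ℝ, Measurable[𝒢 i] Z → (∀ ω, 0 ≤ Z ω) →
      (∃ D, ∀ ω, Z ω ≤ D) → ∫ ω, Z ω * Real.exp (Y i ω) ∂Pr ≤ ∫ ω, Z ω ∂Pr) :
    ∫ ω, Real.exp (∑ i ∈ Finset.range T, Y i ω) ∂Pr ≤ 1 := by
  suffices ∀ t ≤ T, ∫ ω, Real.exp (∑ i ∈ Finset.range t, Y i ω) ∂Pr ≤ 1 from this T le_rfl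
  intro t
  induction t with
  | zero => simp
  | succ t ih =>
    intro ht
    simp only [Finset.sum_range_succ, Real.exp_add]
    refine (hstep t ht _ ?_ (fun ω => (Real.exp_pos _).le) ⟨Real.exp (t * C), fun ω => ?_⟩).trans
      (ih (by omega))
    · refine Real.measurable_exp.comp (Finset.measurable_sum _ fun i hi => ?_)
      have := Finset.mem_range.1 hi
      exact (hY i (by omega)).mono (h𝒢 this) le_rfl
    · refine Real.exp_le_exp.2 ((Finset.sum_le_sum (g := fun _ => C) fun i hi => ?_).trans ?_)
      · have := Finset.mem_range.1 hi
        exact (le_abs_self _).trans (hC i (by omega) ω)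
      · simp

/-- Markov's inequality for exponential moments at most one. -/
lemma measureReal_le_exp_neg [IsProbabilityMeasure Pr] {f : Ω → ℝ} (hf : Measurable f) {C : ℝ}
    (hC : ∀ ω, |f ω| ≤ C) (h1 : ∫ ω, Real.exp (f ω) ∂Pr ≤ 1) (v : ℝ) :
    Pr.real {ω | v ≤ f ω} ≤ Real.exp (-v) := by
  have hint : Integrable (fun ω => Real.exp (f ω)) Pr :=
    integrable_of_abs_le (Real.measurable_exp.comp hf) (C := Real.exp C) fun ω => by
      rw [Real.abs_exp]
      exact Real.exp_le_exp.2 ((le_abs_self _).trans (hC ω))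
  have := mul_meas_ge_le_integral_of_nonneg (Filter.Eventually.of_forall fun ω =>
    (Real.exp_pos (f ω)).le) hint (Real.exp v)
  simp only [Real.exp_le_exp] at this
  rw [Real.exp_neg, ← one_div, le_div_iff₀ (Real.exp_pos v), mul_comm]
  exact this.trans h1

end

namespace TabularMDP

/-! ### Concentration of the empirical kernels. -/

section Stopped

variable {S A : Type*} [DecidableEq S] [DecidableEq A]

lemma sum_transitions_mem (x : ℕ → ℕ → S) (u : ℕ → ℕ → A) (k h : ℕ) (s : S) (a : A)
    (B : Finset S) :
    ∑ i ∈ Finset.range k, (if x i h = s ∧ u i h = a then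
      (if x i (h + 1) ∈ B then (1 : ℝ) else 0) else 0) =
      ∑ s' ∈ B, (transitions x u k h s a s' : ℝ) := by
  induction k with
  | zero => simp [transitions]
  | succ k ih =>
    rw [Finset.sum_range_succ, ih]
    simp only [transitions_succ, Nat.cast_add, Finset.sum_add_distrib]
    by_cases h1 : x k h = s <;> by_cases h2 : u k h = a <;> simp [h1, h2]

lemma sum_visits_indicator (x : ℕ → ℕ → S) (u : ℕ → ℕ → A) (k h : ℕ) (s : S) (a : A) :
    ∑ i ∈ Finset.range k, (if x i h = s ∧ u i h = a then (1 : ℝ) else 0) =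
      visits x u k h s a := by
  simp [visits]

/-- Sums over the first `n` visits agree with sums over the visits before any episode `k` with
exactly `n` earlier visits. -/
lemma sum_first_visits (x : ℕ → ℕ → S) (u : ℕ → ℕ → A) {k K h n : ℕ} {s : S} {a : A}
    (hk : k ≤ K) (hn : visits x u k h s a = n) (f : ℕ → ℝ) :
    ∑ i ∈ Finset.range K, (if (x i h = s ∧ u i h = a) ∧ visits x u i h s a < n then f i else 0) =
      ∑ i ∈ Finset.range k, (if x i h = s ∧ u i h = a then f i else 0) := by
  rw [← Finset.sum_subset (Finset.range_mono hk)]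
  · refine Finset.sum_congr rfl fun i hi => ?_
    by_cases hv : x i h = s ∧ u i h = a
    · have h1 := visits_mono x u h s a (Nat.succ_le_of_lt (Finset.mem_range.1 hi))
      simp only [Nat.succ_eq_add_one, visits_succ, if_pos hv, hn] at h1
      rw [if_pos hv, if_pos ⟨hv, by omega⟩]
    · rw [if_neg hv, if_neg fun h => hv h.1]
  · intro i _ hi
    have h1 := visits_mono x u h s a (not_lt.1 fun h => hi (Finset.mem_range.2 h))
    simp only [hn] at h1
    rw [if_neg fun h => by omega]

end Stopped

section Run

variable {S A : Type*} [Fintype S] [DecidableEq S] [DecidableEq A] {M : TabularMDP S A}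
  {β : BonusKind} {μ α : ℝ} {K : ℕ} {Ω : Type*} {mΩ : MeasurableSpace Ω} {Pr : Measure Ω}
  {ℱ : Filtration ℕ mΩ} {x : ℕ → ℕ → Ω → S} {π : ℕ → Ω → MarkovPolicy S A}

lemma IsUCBVIRun.measurableSet_actions (hrun : M.IsUCBVIRun β μ α K Pr ℱ x π) {k h : ℕ}
    (hk : k < K) (hh : h < M.H) (a : A) :
    MeasurableSet[ℱ (k * M.H + h)] {ω | actions x π ω k h = a} := by
  have : {ω | actions x π ω k h = a} = ⋃ s, {ω | x k h ω = s} ∩ {ω | π k ω h s = a} := by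
    ext ω
    simp [actions]
  rw [this]
  exact MeasurableSet.iUnion fun s => (hrun.state_adapted k hk h hh s).inter
    (ℱ.mono (Nat.le_add_right _ _) _ (hrun.policy_adapted k hk h hh s a))

lemma IsUCBVIRun.measurable_visits (hrun : M.IsUCBVIRun β μ α K Pr ℱ x π) {h : ℕ}
    (hh : h < M.H) (s : S) (a : A) (k : ℕ) (hk : k ≤ K) :
    Measurable[ℱ (k * M.H)] fun ω => visits (fun i j => x i j ω) (actions x π ω) k h s a := by
  induction k with
  | zero => simp only [visits, Finset.range_zero, Finset.filter_empty]; exact measurable_const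
  | succ k ih =>
    simp only [visits_succ]
    have h1 : k * M.H + h ≤ (k + 1) * M.H := by rw [add_mul, one_mul]; omega
    refine Measurable.add ((ih (by omega)).mono (ℱ.mono (by omega)) le_rfl) ?_
    refine Measurable.ite (ℱ.mono h1 _ (MeasurableSet.inter ?_ ?_)) measurable_const
      measurable_const
    · exact hrun.state_adapted k hk h hh s
    · exact hrun.measurableSet_actions hk hh a

/-- The event that the empirical kernel overestimates the probability of `B` at the `n`-th visit. -/
lemma IsUCBVIRun.measureReal_deviation_le [IsProbabilityMeasure Pr]
    (hrun : M.IsUCBVIRun β μ α K Pr ℱ x π) {h : ℕ} (hh : h + 1 < M.H) (s : S) (a : A)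
    (B : Finset S) {n : ℕ} (hn : n ≠ 0) {c : ℝ} (hc : 0 ≤ c) :
    Pr.real {ω | ∃ k < K, visits (fun i j => x i j ω) (actions x π ω) k h s a = n ∧
      √(c / n) < ∑ s' ∈ B,
        (empP (fun i j => x i j ω) (actions x π ω) k h s a s' - M.P h s a s')} ≤
      Real.exp (-(2 * c)) := by
  have hn0 : (0 : ℝ) < n := by exact_mod_cast Nat.pos_of_ne_zero hn
  have hPs := M.P_mem h hh s a
  set q := ∑ s', M.P h s a s' * (if s' ∈ B then (1 : ℝ) else 0) with hq
  have hqB : q = ∑ s' ∈ B, M.P h s a s' := by simp [hq]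
  -- With `ε = √(c / n)`, this maximizes `l n ε - n l² / 8`; the maximum is `2 n ε² = 2 c`.
  set l : ℝ := 4 * √(c / n) with hl
  have hl0 : 0 ≤ l := by positivity
  set f : S → ℝ := fun s' => l * ((if s' ∈ B then (1 : ℝ) else 0) - q) - l ^ 2 / 8 with hf
  -- Stopping after `n` visits lets one sum serve all episodes with exactly `n` earlier visits, so
  -- no union over episodes is needed for fixed `n`.
  let cond : ℕ → Ω → Prop := fun i ω => (x i h ω = s ∧ actions x π ω i h = a) ∧
    visits (fun i j => x i j ω) (actions x π ω) i h s a < n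
  classical
  let Y : ℕ → Ω → ℝ := fun i ω => if cond i ω then f (x i (h + 1) ω) else 0
  let 𝒢 : ℕ → MeasurableSpace Ω := fun i => ℱ (i * M.H + h)
  have h𝒢 : Monotone 𝒢 := fun i j hij => ℱ.mono (by gcongr)
  have hcond : ∀ i < K, MeasurableSet[𝒢 i] {ω | cond i ω} := fun i hi => by
    refine MeasurableSet.inter (MeasurableSet.inter ?_ ?_) ?_
    · exact hrun.state_adapted i hi h (by omega) s
    · exact hrun.measurableSet_actions hi (by omega) a
    · exact ℱ.mono (Nat.le_add_right _ _) _
        (hrun.measurable_visits (by omega) s a i hi.le (measurableSet_Iio (a := n)))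
  have hY : ∀ i < K, Measurable[𝒢 (i + 1)] (Y i) := fun i hi => by
    refine Measurable.ite (h𝒢 i.le_succ _ (hcond i hi)) ?_ measurable_const
    refine measurable_apply_of_fiber (G := fun s' _ => f s') (fun s' => ?_)
      fun _ => measurable_const
    refine ℱ.mono ?_ _ (hrun.state_adapted i hi (h + 1) hh s')
    rw [add_mul, one_mul]
    omega
  obtain ⟨C, hC⟩ : ∃ C, ∀ s', |f s'| ≤ C := by
    obtain ⟨C, hC⟩ := (Set.finite_range fun s' => |f s'|).bddAbove
    exact ⟨C, fun s' => hC ⟨s', rfl⟩⟩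
  have hC0 : 0 ≤ C := (abs_nonneg _).trans (hC s)
  have hYC : ∀ i < K, ∀ ω, |Y i ω| ≤ C := fun i _ ω => by
    by_cases h1 : cond i ω
    · simp only [Y, if_pos h1]; exact hC _
    · simpa only [Y, if_neg h1, abs_zero] using hC0
  have hfsum : ∑ s', M.P h s a s' * Real.exp (f s') ≤ 1 := by
    have h1 := sum_mul_exp_sub_mean_le hPs (f := fun s' => if s' ∈ B then (1 : ℝ) else 0)
      (a := 0) (b := 1) (fun s' => by split_ifs <;> simp) l
    simp only [hf, Real.exp_sub, ← mul_div_assoc, ← Finset.sum_div]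
    rw [div_le_one (Real.exp_pos _)]
    simpa [hqB] using h1
  have hstep := integral_exp_sum_le_one (Pr := Pr) h𝒢 hY hYC fun i hi Z hZ hZ0 hZD => by
    obtain ⟨D, hD⟩ := hZD
    have e : ∀ ω, Real.exp (Y i ω) =
        (fun s' ω => if cond i ω then Real.exp (f s') else 1) (x i (h + 1) ω) ω := fun ω => by
      by_cases h1 : cond i ω <;> simp [Y, h1]
    simp only [e]
    refine integral_mul_apply_le (ℱ.le _)
      (fun s' => ℱ.le _ _ (hrun.state_adapted i hi (h + 1) hh s'))
      (fun s' => hrun.transition i hi h hh s') hZ hZ0 hD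
      (g := fun s' ω => if cond i ω then Real.exp (f s') else 1)
      (fun s' => Measurable.ite (hcond i hi) measurable_const measurable_const)
      (D := max (Real.exp C) 1) (fun s' ω => ?_) fun ω => ?_
    · split_ifs
      · rw [Real.abs_exp]
        exact le_max_of_le_left (Real.exp_le_exp.2 ((le_abs_self _).trans (hC s')))
      · simp
    · by_cases h1 : cond i ω
      · simpa only [if_pos h1, h1.1.1, h1.1.2] using hfsum
      · simp only [if_neg h1, mul_one]
        exact (M.P_mem h hh _ _).2.le
  have hmeas : Measurable fun ω => ∑ i ∈ Finset.range K, Y i ω :=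
    Finset.measurable_sum _ fun i hi =>
      (hY i (Finset.mem_range.1 hi)).mono (ℱ.le _) le_rfl
  refine le_trans (measureReal_mono ?_) (measureReal_le_exp_neg hmeas (C := K * C) (fun ω => ?_)
    hstep (2 * c))
  · rintro ω ⟨k, hk, hv, hlt⟩
    have hsum : ∑ i ∈ Finset.range K, Y i ω = l * (n * ∑ s' ∈ B,
        (empP (fun i j => x i j ω) (actions x π ω) k h s a s' - M.P h s a s')) -
          n * (l ^ 2 / 8) := by
      simp only [Y, cond]
      rw [sum_first_visits (fun i j => x i j ω) (actions x π ω) hk.le hv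
        (fun i => f (x i (h + 1) ω))]
      have e : ∀ i, (if x i h ω = s ∧ actions x π ω i h = a then f (x i (h + 1) ω) else 0) =
          l * (if x i h ω = s ∧ actions x π ω i h = a then
            (if x i (h + 1) ω ∈ B then (1 : ℝ) else 0) else 0) -
          (l * q + l ^ 2 / 8) * (if x i h ω = s ∧ actions x π ω i h = a then 1 else 0) := by
        intro i
        by_cases h1 : x i h ω = s ∧ actions x π ω i h = a
        · simp only [if_pos h1, hf]; ring
        · simp only [if_neg h1]; ring
      simp only [e, Finset.sum_sub_distrib, ← Finset.mul_sum]
      have e1 := sum_transitions_mem (fun i j => x i j ω) (actions x π ω) k h s a B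
      have e2 := sum_visits_indicator (fun i j => x i j ω) (actions x π ω) k h s a
      rw [e1, e2, hv, ← hqB]
      simp only [empP, hv, if_neg hn, ← Finset.sum_div]
      field_simp
      ring
    rw [Set.mem_ofPred_eq, hsum]
    have h1 : √(c / n) ^ 2 * n = c := by
      rw [Real.sq_sqrt (by positivity)]
      field_simp
    have h2 : l * (n * √(c / n)) ≤ l * (n * ∑ s' ∈ B,
        (empP (fun i j => x i j ω) (actions x π ω) k h s a s' - M.P h s a s')) := by gcongr
    have h3 : l * (n * √(c / n)) = 4 * c := by rw [hl]; linear_combination 4 * h1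
    have h4 : n * (l ^ 2 / 8) = 2 * c := by rw [hl]; linear_combination 2 * h1
    linarith
  · refine (Finset.abs_sum_le_sum_abs _ _).trans
      ((Finset.sum_le_sum fun i hi => hYC i (Finset.mem_range.1 hi) ω).trans ?_)
    simp

/-- With high probability the empirical kernels are concentrated in all episodes. -/
lemma IsUCBVIRun.measureReal_not_concentrated_le [Fintype A] [IsProbabilityMeasure Pr]
    (hrun : M.IsUCBVIRun β μ α K Pr ℱ x π) (hμ : 0 < μ) {κ : ℝ} (hκ : 0 ≤ κ) :
    Pr.real {ω | ∃ k < K, ¬ M.Concentrated (fun i j => x i j ω) (actions x π ω)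
      (bonusWidth S μ α κ) k} ≤
      Fintype.card S * Fintype.card A * M.H * (K * Real.exp (-(2 * μ * κ ^ α))) := by
  classical
  set c := bonusWidth S μ α κ with hcdef
  have hc : 0 ≤ c := by
    have : 0 ≤ Real.log 2 := Real.log_nonneg (by norm_num)
    rw [hcdef, bonusWidth]
    positivity
  let E : Fin M.H × S × A × Fin K × Finset S → Set Ω := fun j => {ω | (j.1 : ℕ) + 1 < M.H ∧
    ∃ k < K, visits (fun i j => x i j ω) (actions x π ω) k j.1 j.2.1 j.2.2.1 =
      (j.2.2.2.1 : ℕ) + 1 ∧ √(c / ((j.2.2.2.1 : ℕ) + 1 : ℕ)) < ∑ s' ∈ j.2.2.2.2,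
        (empP (fun i j => x i j ω) (actions x π ω) k j.1 j.2.1 j.2.2.1 s' -
          M.P j.1 j.2.1 j.2.2.1 s')}
  have hE : ∀ j, Pr.real (E j) ≤ Real.exp (-(2 * c)) := fun j => by
    by_cases h1 : (j.1 : ℕ) + 1 < M.H
    · simp only [E, h1, true_and]
      exact hrun.measureReal_deviation_le h1 _ _ _ (Nat.succ_ne_zero _) hc
    · simp only [E, h1, false_and, Set.ofPred_false, measureReal_empty]
      positivity
  have hsub : {ω | ∃ k < K, ¬ M.Concentrated (fun i j => x i j ω) (actions x π ω) c k} ⊆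
      ⋃ j, E j := by
    rintro ω ⟨k, hk, hcon⟩
    simp only [Concentrated, not_forall, not_le] at hcon
    obtain ⟨h, hh, s, a, hn, B, hB⟩ := hcon
    have h1 := visits_le (fun i j => x i j ω) (actions x π ω) k h s a
    obtain ⟨n, hn'⟩ := Nat.exists_eq_succ_of_ne_zero hn
    refine Set.mem_iUnion.2 ⟨(⟨h, by omega⟩, s, a, ⟨n, by omega⟩, B), hh, k, hk, hn', ?_⟩
    rw [hn'] at hB
    exact hB
  calc _ ≤ Pr.real (⋃ j, E j) := measureReal_mono hsub
    _ ≤ ∑ j, Pr.real (E j) := measureReal_iUnion_fintype_le _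
    _ ≤ ∑ _j : Fin M.H × S × A × Fin K × Finset S, Real.exp (-(2 * c)) :=
        Finset.sum_le_sum fun j _ => hE j
    _ = Fintype.card S * Fintype.card A * M.H * (K * Real.exp (-(2 * μ * κ ^ α))) := by
        -- The factor `exp (-(S ln 2))` cancels the number of subsets `B`.
        have : Real.exp (-(2 * c)) =
            ((2 : ℝ) ^ Fintype.card S)⁻¹ * Real.exp (-(2 * μ * κ ^ α)) := by
          rw [hcdef, bonusWidth, ← Real.rpow_natCast, ← Real.rpow_neg zero_le_two,
            Real.rpow_def_of_pos two_pos, ← Real.exp_add]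
          congr 1
          ring
        simp only [Finset.sum_const, Finset.card_univ, Fintype.card_prod, Fintype.card_fin,
          Fintype.card_finset, nsmul_eq_mul, this]
        push_cast
        field_simp

end Run

end TabularMDP

lemma sum_range_mul_eq (f : ℕ → ℝ) (K H : ℕ) :
    ∑ t ∈ Finset.range (K * H), f t =
      ∑ k ∈ Finset.range K, ∑ h ∈ Finset.range H, f (k * H + h) := by
  induction K with
  | zero => simp
  | succ K ih => rw [add_mul, one_mul, Finset.sum_range_add, ih, Finset.sum_range_succ]

namespace TabularMDP

/-! ### Azuma–Hoeffding along a run. -/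

section Run

variable {S A : Type*} [Fintype S] [DecidableEq S] [DecidableEq A] {M : TabularMDP S A}
  {β : BonusKind} {μ α : ℝ} {K : ℕ} {Ω : Type*} {mΩ : MeasurableSpace Ω} {Pr : Measure Ω}
  {ℱ : Filtration ℕ mΩ} {x : ℕ → ℕ → Ω → S} {π : ℕ → Ω → MarkovPolicy S A}

/-- Twice the deviation of `f k h` at the next state from its conditional mean. -/
noncomputable def increment (M : TabularMDP S A) (x : ℕ → ℕ → Ω → S)
    (π : ℕ → Ω → MarkovPolicy S A) (f : ℕ → ℕ → S → Ω → ℝ) (k h : ℕ) (ω : Ω) : ℝ :=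
  if h + 1 < M.H then
    2 * (∑ s', M.P h (x k h ω) (actions x π ω k h) s' * f k h s' ω - f k h (x k (h + 1) ω) ω)
  else 0

/-- The Azuma–Hoeffding inequality along a run. -/
lemma IsUCBVIRun.measureReal_sum_increment_le [Finite A] [IsProbabilityMeasure Pr]
    (hrun : M.IsUCBVIRun β μ α K Pr ℱ x π) {f : ℕ → ℕ → S → Ω → ℝ}
    (hfm : ∀ k < K, ∀ h, h + 1 < M.H → ∀ s, Measurable[ℱ (k * M.H)] (f k h s))
    (hf : ∀ k < K, ∀ h, h + 1 < M.H → ∀ s ω, f k h s ω ∈ Set.Icc (0 : ℝ) M.H)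
    (hK : 0 < K) {z : ℝ} (hz : 0 ≤ z) :
    Pr.real {ω | z ≤ ∑ k ∈ Finset.range K, ∑ h ∈ Finset.range M.H, M.increment x π f k h ω} ≤
      Real.exp (-(z ^ 2 / (2 * (M.H : ℝ) ^ 3 * K))) := by
  rcases Nat.eq_zero_or_pos M.H with hH | hH
  · simp [hH]
  have hH0 : (0 : ℝ) < M.H := by exact_mod_cast hH
  have hK0 : (0 : ℝ) < K := by exact_mod_cast hK
  -- Minimizer of `K H · l² H² / 2 - l z`, with value `-z² / (2 H³ K)`.
  set l : ℝ := z / (K * (M.H : ℝ) ^ 3) with hl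
  have hl0 : 0 ≤ l := by positivity
  let q : ℕ → ℕ → Ω → ℝ := fun k h ω =>
    ∑ s', M.P h (x k h ω) (actions x π ω k h) s' * f k h s' ω
  let G : ℕ → ℕ → S → Ω → ℝ := fun k h s' ω =>
    l * (2 * (q k h ω - f k h s' ω)) - l ^ 2 * (M.H : ℝ) ^ 2 / 2
  -- Time `t = k H + h`. The last stage of an episode has no transition and contributes `0`.
  let Y : ℕ → Ω → ℝ := fun t ω => if t % M.H + 1 < M.H then
    G (t / M.H) (t % M.H) (x (t / M.H) (t % M.H + 1) ω) ω else 0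
  have htime : ∀ t < K * M.H, t / M.H < K ∧ t % M.H < M.H ∧ t / M.H * M.H + t % M.H = t :=
    fun t ht => ⟨Nat.div_lt_of_lt_mul (by rwa [mul_comm]), Nat.mod_lt _ hH, Nat.div_add_mod' t _⟩
  have hq : ∀ k < K, ∀ h, h + 1 < M.H → ∀ ω, q k h ω ∈ Set.Icc (0 : ℝ) M.H := by
    intro k hk h hh ω
    have hP := M.P_mem h hh (x k h ω) (actions x π ω k h)
    refine ⟨Finset.sum_nonneg fun s' _ => mul_nonneg (hP.1 s') (hf k hk h hh s' ω).1, ?_⟩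
    calc q k h ω ≤ ∑ s', M.P h (x k h ω) (actions x π ω k h) s' * M.H :=
          Finset.sum_le_sum fun s' _ =>
            mul_le_mul_of_nonneg_left (hf k hk h hh s' ω).2 (hP.1 s')
      _ = M.H := by rw [← Finset.sum_mul, hP.2, one_mul]
  have hqm : ∀ k < K, ∀ h, h + 1 < M.H → Measurable[ℱ (k * M.H + h)] (q k h) := by
    intro k hk h hh
    refine Finset.measurable_sum _ fun s' _ => Measurable.mul ?_
      ((hfm k hk h hh s').mono (ℱ.mono (Nat.le_add_right _ _)) le_rfl)
    refine measurable_apply_of_fiber (m := ℱ (k * M.H + h))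
      (φ := fun ω => (x k h ω, actions x π ω k h))
      (G := fun p _ => M.P h p.1 p.2 s') (fun p => ?_) fun _ => measurable_const
    have : {ω | (x k h ω, actions x π ω k h) = p} =
        {ω | x k h ω = p.1} ∩ {ω | actions x π ω k h = p.2} := by
      ext ω
      simp [Prod.ext_iff]
    rw [this]
    exact (hrun.state_adapted k hk h (by omega) p.1).inter
      (hrun.measurableSet_actions hk (by omega) p.2)
  have hGm : ∀ k < K, ∀ h, h + 1 < M.H → ∀ s', Measurable[ℱ (k * M.H + h)] (G k h s') := by
    intro k hk h hh s'
    exact (((hqm k hk h hh).sub ((hfm k hk h hh s').mono (ℱ.mono (Nat.le_add_right _ _))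
      le_rfl)).const_mul 2 |>.const_mul l).sub_const _
  have hGb : ∀ k < K, ∀ h, h + 1 < M.H → ∀ s' ω,
      |G k h s' ω| ≤ l * (2 * M.H) + l ^ 2 * (M.H : ℝ) ^ 2 / 2 := by
    intro k hk h hh s' ω
    have h1 := hq k hk h hh ω
    have h2 := hf k hk h hh s' ω
    have h3 : |l * (2 * (q k h ω - f k h s' ω))| ≤ l * (2 * M.H) := by
      rw [abs_mul, abs_of_nonneg hl0, abs_mul, abs_two]
      gcongr
      exact abs_le.2 ⟨by linarith [h1.1, h2.2], by linarith [h1.2, h2.1]⟩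
    refine (abs_sub _ _).trans (add_le_add h3 (le_of_eq (abs_of_nonneg (by positivity))))
  have hC0 : 0 ≤ l * (2 * M.H) + l ^ 2 * (M.H : ℝ) ^ 2 / 2 := by positivity
  have hYm : ∀ t < K * M.H, Measurable[ℱ (t + 1)] (Y t) := by
    intro t ht
    obtain ⟨hk, hh, e⟩ := htime t ht
    by_cases h1 : t % M.H + 1 < M.H
    · simp only [Y, if_pos h1]
      refine measurable_apply_of_fiber (m := ℱ (t + 1)) (fun s' => ?_) fun s' => ?_
      · have := hrun.state_adapted _ hk _ h1 s'
        rwa [← add_assoc, e] at this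
      · have := hGm _ hk _ h1 s'
        rw [e] at this
        exact this.mono (ℱ.mono t.le_succ) le_rfl
    · simp only [Y, if_neg h1]
      exact measurable_const
  have hYb : ∀ t < K * M.H, ∀ ω, |Y t ω| ≤ l * (2 * M.H) + l ^ 2 * (M.H : ℝ) ^ 2 / 2 := by
    intro t ht ω
    by_cases h1 : t % M.H + 1 < M.H
    · simp only [Y, if_pos h1]
      exact hGb _ (htime t ht).1 _ h1 _ _
    · simpa only [Y, if_neg h1, abs_zero] using hC0
  have hstep := integral_exp_sum_le_one (Pr := Pr) (𝒢 := fun t => ℱ t) (fun _ _ h => ℱ.mono h) hYm hYb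
    fun t ht Z hZ hZ0 hZD => by
      obtain ⟨D, hD⟩ := hZD
      obtain ⟨hk, hh, e⟩ := htime t ht
      by_cases h1 : t % M.H + 1 < M.H
      · simp only [Y, if_pos h1]
        have htr := hrun.transition _ hk _ h1
        have hgm := hGm _ hk _ h1
        rw [e] at htr hgm
        refine integral_mul_apply_le (ℱ.le t)
          (fun s' => ℱ.le _ _ (hrun.state_adapted _ hk _ h1 s')) htr hZ hZ0 hD
          (g := fun s' ω => Real.exp (G (t / M.H) (t % M.H) s' ω))
          (fun s' => Real.measurable_exp.comp (hgm s'))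
          (D := Real.exp (l * (2 * M.H) + l ^ 2 * (M.H : ℝ) ^ 2 / 2)) (fun s' ω => ?_) fun ω => ?_
        · rw [Real.abs_exp]
          exact Real.exp_le_exp.2 ((le_abs_self _).trans (hGb _ hk _ h1 s' ω))
        -- The increment is `-2` times the centred value of `f`, which has range `H`; Hoeffding's
        -- lemma gives `(2 l)² H² / 8 = l² H² / 2`.
        · have h2 := sum_mul_exp_sub_mean_le
            (M.P_mem _ h1 (x (t / M.H) (t % M.H) ω) (actions x π ω (t / M.H) (t % M.H)))
            (fun s' => hf _ hk _ h1 s' ω) (-(2 * l))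
          simp only [G, Real.exp_sub, ← mul_div_assoc, ← Finset.sum_div]
          rw [div_le_one (Real.exp_pos _)]
          refine (le_of_eq (Finset.sum_congr rfl fun s' _ => ?_)).trans
            (h2.trans (le_of_eq ?_))
          · congr 2
            simp only [q]
            ring
          · congr 1
            ring
      · simp [Y, if_neg h1]
  have hmeas : Measurable fun ω => ∑ t ∈ Finset.range (K * M.H), Y t ω :=
    Finset.measurable_sum _ fun t ht =>
      (hYm t (Finset.mem_range.1 ht)).mono (ℱ.le _) le_rfl
  refine le_trans (measureReal_mono ?_) (measureReal_le_exp_neg hmeas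
    (C := (K * M.H : ℕ) * (l * (2 * M.H) + l ^ 2 * (M.H : ℝ) ^ 2 / 2)) (fun ω => ?_) hstep _)
  · intro ω hω
    rw [Set.mem_ofPred_eq] at hω ⊢
    have h1 : ∑ t ∈ Finset.range (K * M.H), Y t ω =
        ∑ k ∈ Finset.range K, ∑ h ∈ Finset.range M.H, (if h + 1 < M.H then
          G k h (x k (h + 1) ω) ω else 0) := by
      rw [sum_range_mul_eq]
      refine Finset.sum_congr rfl fun k _ => Finset.sum_congr rfl fun h hh => ?_
      have hh' := Finset.mem_range.1 hh
      have e1 : (k * M.H + h) % M.H = h := by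
        rw [Nat.mul_add_mod_self_right, Nat.mod_eq_of_lt hh']
      have e2 : (k * M.H + h) / M.H = k := by
        rw [mul_comm, Nat.mul_add_div hH, Nat.div_eq_of_lt hh', add_zero]
      simp only [Y, e1, e2]
    -- The compensator is subtracted at the last stages too, which only lowers the left side and
    -- gives the count `K H`.
    have h2 : ∀ k h, l * M.increment x π f k h ω - l ^ 2 * (M.H : ℝ) ^ 2 / 2 ≤
        if h + 1 < M.H then G k h (x k (h + 1) ω) ω else 0 := by
      intro k h
      unfold increment
      split_ifs
      · exact le_rfl
      · have : 0 ≤ l ^ 2 * (M.H : ℝ) ^ 2 / 2 := by positivity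
        linarith
    have h3 : l * (∑ k ∈ Finset.range K, ∑ h ∈ Finset.range M.H, M.increment x π f k h ω) -
        K * (M.H * (l ^ 2 * (M.H : ℝ) ^ 2 / 2)) ≤ ∑ t ∈ Finset.range (K * M.H), Y t ω := by
      rw [h1]
      refine le_trans (le_of_eq ?_)
        (Finset.sum_le_sum fun k _ => Finset.sum_le_sum fun h _ => h2 k h)
      simp only [Finset.sum_sub_distrib, ← Finset.mul_sum, Finset.sum_const, Finset.card_range,
        nsmul_eq_mul]
      ring
    refine le_trans (le_of_eq ?_) ((sub_le_sub_right (mul_le_mul_of_nonneg_left hω hl0) _).trans h3)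
    rw [hl]
    field_simp
    ring
  · refine (Finset.abs_sum_le_sum_abs _ _).trans
      ((Finset.sum_le_sum fun t ht => hYb t (Finset.mem_range.1 ht) ω).trans ?_)
    rw [Finset.sum_const, Finset.card_range, nsmul_eq_mul]

/-- Policy and visit counts are fixed when the episode starts, so the potential is predictable, as
Azuma–Hoeffding requires. -/
lemma IsUCBVIRun.measurable_potential [Finite A] (hrun : M.IsUCBVIRun β μ α K Pr ℱ x π) {k : ℕ}
    (hk : k < K) (c : ℝ) :
    ∀ h ≤ M.H, ∀ s, Measurable[ℱ (k * M.H)] fun ω => M.potential (fun h s a =>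
      M.clippedBonus c h (visits (fun i j => x i j ω) (actions x π ω) k h s a)) (π k ω) h s := by
  refine M.stage_induction (fun s => ?_) fun h hh ih s => ?_
  · simp only [potential_horizon]
    exact measurable_const
  · simp only [M.potential_eq _ _ hh]
    refine measurable_const.min ?_
    refine measurable_apply_of_fiber (m := ℱ (k * M.H)) (φ := fun ω => π k ω h s)
      (G := fun a ω => M.clippedBonus c h
        (visits (fun i j => x i j ω) (actions x π ω) k h s a) +
          ∑ s', M.P h s a s' * M.potential (fun h s a => M.clippedBonus c h
            (visits (fun i j => x i j ω) (actions x π ω) k h s a)) (π k ω) (h + 1) s')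
      (fun a => hrun.policy_adapted k hk h hh s a) fun a => ?_
    refine Measurable.add ?_ (Finset.measurable_sum _ fun s' _ => (ih s').const_mul _)
    exact (measurable_from_nat (f := M.clippedBonus c h)).comp
      (hrun.measurable_visits hh s a k hk.le)

end Run

end TabularMDP

namespace TabularMDP

/-! ### Pathwise regret bound. -/

section Regret

variable {S A : Type*} [Fintype S] [DecidableEq S] [DecidableEq A] {M : TabularMDP S A}
  {β : BonusKind} {μ α : ℝ} {K : ℕ} {Ω : Type*} {x : ℕ → ℕ → Ω → S} {π : ℕ → Ω → MarkovPolicy S A}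

/-- The clipped bonus of a state-action pair in episode `k`. -/
noncomputable def episodeBonus (M : TabularMDP S A) (x : ℕ → ℕ → Ω → S)
    (π : ℕ → Ω → MarkovPolicy S A) (c : ℝ) (k : ℕ) (ω : Ω) (h : ℕ) (s : S) (a : A) : ℝ :=
  M.clippedBonus c h (visits (fun i j => x i j ω) (actions x π ω) k h s a)

/-- The potential at the next stage, from episode `k₀` on. -/
noncomputable def nextPotential (M : TabularMDP S A) (x : ℕ → ℕ → Ω → S)
    (π : ℕ → Ω → MarkovPolicy S A) (c : ℝ) (k₀ k h : ℕ) (s : S) (ω : Ω) : ℝ :=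
  if k₀ ≤ k then M.potential (M.episodeBonus x π c k ω) (π k ω) (h + 1) s else 0

/-- Along the trajectory, the potential is at most the collected bonuses plus the increments. -/
lemma potential_le_sum (c : ℝ) {k₀ k : ℕ} (hk : k₀ ≤ k) (ω : Ω) :
    ∀ h ≤ M.H, 2 * M.potential (M.episodeBonus x π c k ω) (π k ω) h (x k h ω) ≤
      ∑ j ∈ Finset.Ico h M.H,
        (2 * M.episodeBonus x π c k ω j (x k j ω) (actions x π ω k j) +
          M.increment x π (M.nextPotential x π c k₀) k j ω) := by
  refine M.stage_induction (by simp [potential_horizon]) fun h hh ih => ?_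
  rw [Finset.sum_eq_sum_Ico_succ_bot hh]
  have h1 : M.potential (M.episodeBonus x π c k ω) (π k ω) h (x k h ω) ≤ _ :=
    (M.potential_eq _ _ hh _).le.trans (min_le_right _ _)
  have h2 : 2 * ∑ s', M.P h (x k h ω) (π k ω h (x k h ω)) s' *
      M.potential (M.episodeBonus x π c k ω) (π k ω) (h + 1) s' =
      M.increment x π (M.nextPotential x π c k₀) k h ω +
        2 * M.potential (M.episodeBonus x π c k ω) (π k ω) (h + 1) (x k (h + 1) ω) := by
    unfold increment nextPotential
    simp only [if_pos hk]
    split_ifs with h3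
    · rw [actions]
      ring
    · have h4 : h + 1 = M.H := by omega
      simp [h4, potential_horizon]
  have h3 : M.episodeBonus x π c k ω h (x k h ω) (actions x π ω k h) =
    M.episodeBonus x π c k ω h (x k h ω) (π k ω h (x k h ω)) := rfl
  linarith

/-- The regret when the empirical kernels are concentrated. -/
lemma regret_le [Fintype A] [Nonempty A] (hH : 2 ≤ M.H) (hM : M.gapSet.Nonempty) (hμ : 0 < μ)
    {c : ℝ} {k₀ : ℕ} (hlow : ∀ k < K, k₀ ≤ k → c ≤ bonusWidth S μ α (β.scale K k))
    (hupp : ∀ k < K, bonusWidth S μ α (β.scale K k) ≤ bonusWidth S μ α K) {ω : Ω}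
    (hstart : ∀ k < K, x k 0 ω = M.s₀)
    (hgreedy : ∀ k < K, ∀ h < M.H, ∀ s a,
      M.planQ β μ α K (fun i j => x i j ω) (actions x π ω) k h s a ≤
        M.planQ β μ α K (fun i j => x i j ω) (actions x π ω) k h s (π k ω h s))
    (hconc : ∀ k < K, M.Concentrated (fun i j => x i j ω) (actions x π ω) c k) :
    M.regret K π ω ≤ M.H * k₀ + M.baseline μ α K + ∑ k ∈ Finset.range K,
      ∑ h ∈ Finset.range M.H,
        M.increment x π (M.nextPotential x π (bonusWidth S μ α K) k₀) k h ω := by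
  have hg0 := (M.gap_pos hM).le
  have hg := M.gap_le_horizon hM
  set C := bonusWidth S μ α K
  have hb : ∀ k h, h < M.H → ∀ s a, 0 ≤ M.episodeBonus x π C k ω h s a :=
    fun k h hh s a => M.clippedBonus_nonneg hH hg C hh _
  have hepisode : ∀ k < K, M.optValue 0 M.s₀ - M.value (π k ω) 0 M.s₀ ≤
      (if k < k₀ then (M.H : ℝ) else 0) + ∑ h ∈ Finset.range M.H,
        (2 * M.episodeBonus x π C k ω h (x k h ω) (actions x π ω k h) +
          M.increment x π (M.nextPotential x π C k₀) k h ω) := by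
    intro k hk
    by_cases hkk : k < k₀
    · rw [if_pos hkk]
      have h1 := (M.optValue_mem (Nat.zero_le M.H) M.s₀).2
      have h2 := (M.value_mem (π k ω) 0 (Nat.zero_le _) M.s₀).1
      -- Before `k₀` the potential is set to zero, so the increments vanish and `H` alone covers the
      -- episode.
      have h3 : 0 ≤ ∑ h ∈ Finset.range M.H,
          (2 * M.episodeBonus x π C k ω h (x k h ω) (actions x π ω k h) +
            M.increment x π (M.nextPotential x π C k₀) k h ω) :=
        Finset.sum_nonneg fun h hh => by
          have := hb k h (Finset.mem_range.1 hh) (x k h ω) (actions x π ω k h)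
          simp only [increment, nextPotential, if_neg (not_le.2 hkk)]
          simpa using this
      push_cast at h1
      linarith
    · rw [if_neg hkk, zero_add, Finset.range_eq_Ico]
      have h1 := ((hconc k hk).mono (hlow k hk (not_lt.1 hkk))).optValue_sub_le_potential hH hg0 hg
        (hupp k hk) (hgreedy k hk) 0 (Nat.zero_le _) M.s₀
      refine h1.trans ?_
      have h2 := M.potential_le_sum (x := x) (π := π) C (not_lt.1 hkk) ω 0 (Nat.zero_le _)
      rwa [hstart k hk] at h2
  have hk0 : ∑ k ∈ Finset.range K, (if k < k₀ then (M.H : ℝ) else 0) ≤ M.H * k₀ := by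
    rw [← Finset.sum_filter, Finset.sum_const, nsmul_eq_mul, mul_comm]
    refine mul_le_mul_of_nonneg_left ?_ (Nat.cast_nonneg _)
    have : (Finset.range K).filter (· < k₀) ⊆ Finset.range k₀ := fun k hk =>
      Finset.mem_range.2 (Finset.mem_filter.1 hk).2
    exact_mod_cast (Finset.card_le_card this).trans (Finset.card_range _).le
  have hbase : 2 * ∑ k ∈ Finset.range K, ∑ h ∈ Finset.range M.H,
      M.episodeBonus x π C k ω h (x k h ω) (actions x π ω k h) ≤ M.baseline μ α K := by
    rw [Finset.sum_comm]
    exact M.sum_clippedBonus_visits_le hH hM hμ K (fun i j => x i j ω) (actions x π ω)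
  calc M.regret K π ω
      ≤ ∑ k ∈ Finset.range K, ((if k < k₀ then (M.H : ℝ) else 0) + ∑ h ∈ Finset.range M.H,
          (2 * M.episodeBonus x π C k ω h (x k h ω) (actions x π ω k h) +
            M.increment x π (M.nextPotential x π C k₀) k h ω)) :=
        Finset.sum_le_sum fun k hk => hepisode k (Finset.mem_range.1 hk)
    _ ≤ _ := by
        simp only [Finset.sum_add_distrib, ← Finset.mul_sum]
        linarith

omit [DecidableEq A] in
/-- Without suboptimal actions there is no regret. -/
lemma regret_eq_zero [Fintype A] [Nonempty A] (hM : ¬ M.gapSet.Nonempty) (ω : Ω) :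
    M.regret K π ω = 0 := by
  have hopt : ∀ h < M.H, ∀ s a, M.IsOptAction h s a := by
    intro h hh s a
    by_contra ha
    obtain ⟨b, hb⟩ := M.exists_isOptAction h s
    exact hM ⟨_, h, hh, s, b, a, hb, ha, rfl⟩
  have hval : ∀ π : MarkovPolicy S A, ∀ h ≤ M.H, ∀ s, M.value π h s = M.optValue h s := by
    intro π
    refine M.stage_induction (fun s => by rw [M.value_of_le π le_rfl, M.optValue_horizon])
      fun h hh ih s => ?_
    rw [M.value_eq π hh, M.optValue_eq_optQ hh (hopt h hh s (π h s)), optQ]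
    simp only [ih]
  simp [regret, hval _ 0 (Nat.zero_le _)]

omit [DecidableEq A] in
-- With this default value the division in `baseline` gives `0`, matching an infinite gap.
lemma gap_eq_zero (hM : ¬ M.gapSet.Nonempty) : M.gap = 0 := by
  rw [gap_eq_sInf, Set.not_nonempty_iff_eq_empty.1 hM, Real.sInf_empty]

end Regret

/-- The scale of the bonus that all episodes `k ≥ K ^ γ` reach. -/
noncomputable def lowerScale (β : BonusKind) (γ : ℝ) (K : ℕ) : ℝ :=
  match β with
  | .kDependent => K
  | .kIndependent => (K : ℝ) ^ γ

lemma lowerScale_nonneg (β : BonusKind) (γ : ℝ) (K : ℕ) : 0 ≤ lowerScale β γ K := by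
  cases β <;> simp only [lowerScale] <;> positivity

lemma lowerScale_le (β : BonusKind) (γ : ℝ) {K k : ℕ} (hk : ⌈(K : ℝ) ^ γ⌉₊ ≤ k) :
    lowerScale β γ K ≤ β.scale K k := by
  cases β
  · exact le_rfl
  · have := Nat.ceil_le.1 hk
    simp only [lowerScale, BonusKind.scale]
    linarith

lemma _root_.BonusKind.scale_le (β : BonusKind) {K k : ℕ} (hk : k < K) : β.scale K k ≤ K := by
  cases β
  · exact le_rfl
  · simp only [BonusKind.scale]
    exact_mod_cast hk

lemma _root_.BonusKind.scale_nonneg (β : BonusKind) (K k : ℕ) : 0 ≤ β.scale K k := by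
  cases β <;> simp only [BonusKind.scale] <;> positivity

lemma bonusWidth_mono (S : Type*) [Fintype S] {μ α : ℝ} (hμ : 0 < μ) (hα : 0 ≤ α) {κ κ' : ℝ}
    (h0 : 0 ≤ κ) (h : κ ≤ κ') : bonusWidth S μ α κ ≤ bonusWidth S μ α κ' := by
  unfold bonusWidth
  gcongr

lemma residual_eq {S A : Type*} [Fintype S] [Fintype A] (M : TabularMDP S A) (β : BonusKind)
    (μ α γ : ℝ) (K : ℕ) : M.residual β μ α γ K = Fintype.card S * Fintype.card A * M.H *
      (K * Real.exp (-(2 * μ * lowerScale β γ K ^ α))) := by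
  cases β
  · rfl
  · simp only [residual, lowerScale]
    rw [Real.rpow_mul (Nat.cast_nonneg K)]

end TabularMDP

/-! ### Assembly of the tail bound. -/

theorem theorem1 {S A : Type*} [Fintype S] [DecidableEq S] [Fintype A] [DecidableEq A] [Nonempty A]
    (M : TabularMDP S A) (hH : 2 ≤ M.H) (β : BonusKind) (μ : ℝ) (hμ : 0 < μ)
    (α : ℝ) (hα : α ∈ Set.Icc (0 : ℝ) 1) (K : ℕ)
    {Ω : Type*} {mΩ : MeasurableSpace Ω} (Pr : Measure Ω) [IsProbabilityMeasure Pr]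
    (ℱ : Filtration ℕ mΩ) (x : ℕ → ℕ → Ω → S) (π : ℕ → Ω → MarkovPolicy S A)
    (hrun : M.IsUCBVIRun β μ α K Pr ℱ x π)
    (γ : ℝ) (hγ : γ ∈ Set.Icc (0 : ℝ) 1) (y : ℝ) :
    Pr.real {ω | y ≤ M.regret K π ω} ≤
      Real.exp (-((max (y - M.H * (⌈(K : ℝ) ^ γ⌉₊ : ℝ) - M.baseline μ α K) 0) ^ 2 /
        (2 * (M.H : ℝ) ^ 3 * K))) + M.residual β μ α γ K := by
  have hres : 0 ≤ M.residual β μ α γ K := by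
    rw [M.residual_eq]
    positivity
  set k₀ := ⌈(K : ℝ) ^ γ⌉₊
  set z := y - M.H * (k₀ : ℝ) - M.baseline μ α K with hz
  -- For `z ≤ 0` the exponential is `1` and the bound is trivial.
  rcases le_or_gt z 0 with hz0 | hz0
  · rw [max_eq_right hz0]
    simpa using measureReal_le_one.trans (le_add_of_nonneg_right hres)
  rw [max_eq_left hz0.le]
  by_cases hM : M.gapSet.Nonempty
  swap
  · have hy : 0 < y := by
      have hb : M.baseline μ α K = 0 := by
        simp [TabularMDP.baseline, TabularMDP.gap_eq_zero hM]
      have : (0 : ℝ) ≤ M.H * (k₀ : ℝ) := by positivity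
      rw [hb] at hz
      linarith
    simp only [TabularMDP.regret_eq_zero hM, not_le.2 hy, Set.ofPred_false, measureReal_empty]
    positivity
  -- For `K = 0` the exponent is a division by zero, so the exponential is again `1`.
  rcases Nat.eq_zero_or_pos K with hK | hK
  · subst hK
    simpa using measureReal_le_one.trans (le_add_of_nonneg_right hres)
  have hg := M.gap_le_horizon hM
  set C := TabularMDP.bonusWidth S μ α K
  set c := TabularMDP.bonusWidth S μ α (TabularMDP.lowerScale β γ K)
  have hbon : ∀ k ω, ∀ h < M.H, ∀ s a, 0 ≤ M.episodeBonus x π C k ω h s a :=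
    fun k ω h hh s a => M.clippedBonus_nonneg hH hg C hh _
  have hazuma := hrun.measureReal_sum_increment_le (f := M.nextPotential x π C k₀)
    (fun k hk h hh s => by
      unfold TabularMDP.nextPotential
      split_ifs
      · exact hrun.measurable_potential hk C (h + 1) hh.le s
      · exact measurable_const)
    (fun k hk h hh s ω => by
      unfold TabularMDP.nextPotential
      split_ifs
      · have := M.potential_mem (hbon k ω) (π k ω) (h + 1) hh.le s
        exact ⟨this.1, this.2.trans (sub_le_self _ (Nat.cast_nonneg _))⟩
      · exact ⟨le_rfl, Nat.cast_nonneg _⟩) hK hz0.le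
  have hdev := hrun.measureReal_not_concentrated_le hμ (TabularMDP.lowerScale_nonneg β γ K)
  rw [← M.residual_eq] at hdev
  refine le_trans ?_ ((measureReal_union_le _ _).trans (add_le_add hazuma hdev))
  -- Initial state and greediness hold only almost surely, so the regret event is covered up to a
  -- null set.
  refine ENNReal.toReal_mono (measure_ne_top _ _) (measure_mono_ae ?_)
  have hstart : ∀ᵐ ω ∂Pr, ∀ k < K, x k 0 ω = M.s₀ :=
    ae_all_iff.2 fun k => Filter.eventually_imp_distrib_left.2 fun hk => hrun.start k hk
  have hgreedy := ae_all_iff.2 fun k => Filter.eventually_imp_distrib_left.2 fun hk => hrun.greedy k hk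
  filter_upwards [hstart, hgreedy] with ω h1 h2 h3
  by_cases h4 : ∃ k < K, ¬ M.Concentrated (fun i j => x i j ω) (TabularMDP.actions x π ω) c k
  · exact Or.inr h4
  · push Not at h4
    have h5 := TabularMDP.regret_le hH hM hμ (k₀ := k₀)
      (fun k _ hkk => TabularMDP.bonusWidth_mono S hμ hα.1 (TabularMDP.lowerScale_nonneg β γ K)
        (TabularMDP.lowerScale_le β γ hkk))
      (fun k hk => TabularMDP.bonusWidth_mono S hμ hα.1 (β.scale_nonneg K k) (β.scale_le hk))
      h1 h2 h4
    have h6 : y ≤ M.regret K π ω := h3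
    refine Or.inl ?_
    rw [Set.mem_ofPred_eq, hz]
    linarith
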